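/- Let $d\ge 1$, let $\Omega'\subset\mathbb{R}^d$ be a bounded smooth domain (open and connected), $H>0$ and $\Omega=\Omega'\times(0,H)$. Let $(\mu_k^2,\phi_k)_{k\ge1}$, $\mu_k\ge 0$, be the eigenpairs of $-\Delta$ in $L^2(\Omega')$ with domain $H^2(\Omega')\cap H^1_0(\Omega')$: the eigenvalues are nondecreasing and repeated according to multiplicity, and the $\phi_k$ form an orthonormal basis of $L^2(\Omega')$. Fix $0<c_m<c_M$, $\varepsilon>0$ and $V>0$. Let $\mathcal{K}$ be the set of measurable $c$ on $(0,H)$ with $c_m\le c\le c_M$ almost everywhere, and let $\mathcal{K}_V=\{c\in\mathcal{K}: TV(c)\le V\}$, where $TV(c)$ is the total variation of $c$ on $(0,H)$ (the least variation of a function equal to $c$ almost everywhere). For $c\in\mathcal{K}$ let $A_k=c(y)\big(\mu_k^2-\frac{d^2}{dy^2}\big)$ with domain $H^2(0,H)\cap H^1_0(0,H)$, and let $\mathcal{A}^c_\varepsilon$ be the set of pairs $(k,\lambda)$ such that $\lambda$ is an eigenvalue of $A_k$ and $\lambda\ge(\operatorname{ess\,sup}c+\varepsilon)\mu_k^2$.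 For such a pair let $u_{\lambda,k}$ denote an eigenfunction of $A_k$ for $\lambda$ with $\int_0^H u_{\lambda,k}^2\,c^{-1}dy=1$ (it is unique up to sign), and let $v_\lambda(x',y)=\phi_k(x')u_{\lambda,k}(y)$. Put $$\mathfrak{r}_c^2=\inf\{u_{\lambda,k}(y)^2+u_{\lambda,k}'(y)^2:\ y\in[0,H],\ (k,\lambda)\in\mathcal{A}^c_\varepsilon\}.$$ Then: 1. $\mathfrak{r}_c^2>0$ for every $c\in\mathcal{K}$ of bounded variation (the minimal amplitude hypothesis). 2. $\inf_{c\in\mathcal{K}_V}\mathfrak{r}_c^2>0$. 3. For all $0\le a<b\le H$ there is $\mathfrak{f}_{a,b}>0$ such that $\int_a^b u_{\lambda,k}^2\,c^{-1}dy\ge\mathfrak{f}_{a,b}$ for all $c\in\mathcal{K}_V$ and all $(k,\lambda)\in\mathcal{A}^c_\varepsilon$. 4. Let $0\le a<b\le H$, let $\omega'\subseteq\Omega'$ be open and let $\omega=\omega'\times(a,b)$. If $\omega'\ne\Omega'$, assume that $(\phi_k)$ does not concentrate in $\Omega'\setminus\omega'$, that is, $$\liminf_{k\to\infty}\frac{\|\phi_k\|^2_{L^2(\omega')}}{\|\phi_k\|^2_{L^2(\Omega')}}>0.$$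 Then there is $\mathfrak{f}_\omega>0$ such that $$\mathfrak{f}_\omega\le\frac{\|v_\lambda\|_{L^2(\omega)}}{\|v_\lambda\|_{L^2(\Omega)}}\le 1$$ for all $c\in\mathcal{K}_V$ and all $(k,\lambda)\in\mathcal{A}^c_\varepsilon$. -/

import Mathlib

open MeasureTheory Set Filter
open scoped ENNReal ContDiff

noncomputable section

namespace Layered

/-! ### Sobolev notions and the Dirichlet Laplacian on an open subset of Euclidean space -/

/-- Smooth functions with compact support contained in `D`. -/
def IsTestFunction {d : ℕ} (D : Set (EuclideanSpace ℝ (Fin d)))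
    (ψ : EuclideanSpace ℝ (Fin d) → ℝ) : Prop :=
  ContDiff ℝ ∞ ψ ∧ HasCompactSupport ψ ∧ tsupport ψ ⊆ D

/-- Classical partial derivative in the `i`-th coordinate direction. -/
def pderiv {d : ℕ} (i : Fin d) (ψ : EuclideanSpace ℝ (Fin d) → ℝ) :
    EuclideanSpace ℝ (Fin d) → ℝ :=
  fun x => fderiv ℝ ψ x (EuclideanSpace.single i 1)

/-- `g` is the `i`-th weak partial derivative of `f` in `D` (for `f`, `g` in `L²(D)`). -/
def HasWeakPartial {d : ℕ} (D : Set (EuclideanSpace ℝ (Fin d))) (i : Fin d)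
    (f g : EuclideanSpace ℝ (Fin d) → ℝ) : Prop :=
  ∀ ψ, IsTestFunction D ψ → ∫ x in D, f x * pderiv i ψ x = - ∫ x in D, g x * ψ x

/-- `f ∈ H²(D)`, with weak gradient `g` and weak Hessian `h`. -/
def HasH2Derivs {d : ℕ} (D : Set (EuclideanSpace ℝ (Fin d)))
    (f : EuclideanSpace ℝ (Fin d) → ℝ) (g : Fin d → EuclideanSpace ℝ (Fin d) → ℝ)
    (h : Fin d → Fin d → EuclideanSpace ℝ (Fin d) → ℝ) : Prop :=
  MemLp f 2 (volume.restrict D) ∧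
  (∀ i, MemLp (g i) 2 (volume.restrict D) ∧ HasWeakPartial D i f (g i)) ∧
  (∀ i j, MemLp (h i j) 2 (volume.restrict D) ∧ HasWeakPartial D j (g i) (h i j))

/-- `f ∈ H¹₀(D)`, where `g` is the weak gradient of `f`: the pair `(f, g)` is the `H¹` limit of
test functions and their gradients. -/
def MemH10 {d : ℕ} (D : Set (EuclideanSpace ℝ (Fin d)))
    (f : EuclideanSpace ℝ (Fin d) → ℝ) (g : Fin d → EuclideanSpace ℝ (Fin d) → ℝ) : Prop :=
  MemLp f 2 (volume.restrict D) ∧ (∀ i, MemLp (g i) 2 (volume.restrict D)) ∧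
  ∃ ψ : ℕ → EuclideanSpace ℝ (Fin d) → ℝ, (∀ n, IsTestFunction D (ψ n)) ∧
    Tendsto (fun n => eLpNorm (fun x => ψ n x - f x) 2 (volume.restrict D)) atTop (nhds 0) ∧
    ∀ i, Tendsto (fun n => eLpNorm (fun x => pderiv i (ψ n) x - g i x) 2 (volume.restrict D))
      atTop (nhds 0)

/-- `f ∈ H²(D) ∩ H¹₀(D)` and `-Δ f = ν f` in `D`. -/
def SolvesDirichlet {d : ℕ} (D : Set (EuclideanSpace ℝ (Fin d))) (ν : ℝ)
    (f : EuclideanSpace ℝ (Fin d) → ℝ) : Prop :=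
  ∃ g h, HasH2Derivs D f g h ∧ MemH10 D f g ∧
    ∀ᵐ x ∂(volume.restrict D), - ∑ i, h i i x = ν * f x

/-- `(μ_k², φ_k)` is the sequence of eigenpairs of the Dirichlet Laplacian `-Δ` in `L²(D)` with
domain `H²(D) ∩ H¹₀(D)`: the eigenvalues are nondecreasing and counted with multiplicity, and the
`φ_k` form an orthonormal basis of `L²(D)`. -/
structure IsDirichletSystem {d : ℕ} (D : Set (EuclideanSpace ℝ (Fin d))) (μ : ℕ → ℝ)
    (φ : ℕ → EuclideanSpace ℝ (Fin d) → ℝ) : Prop where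
  nonneg : ∀ k, 0 ≤ μ k
  mono : Monotone μ
  eigen : ∀ k, SolvesDirichlet D (μ k ^ 2) (φ k)
  orthonormal : ∀ j k, ∫ x in D, φ j x * φ k x = if j = k then 1 else 0
  complete : ∀ f : EuclideanSpace ℝ (Fin d) → ℝ, MemLp f 2 (volume.restrict D) →
    (∀ k, ∫ x in D, f x * φ k x = 0) → f =ᵐ[volume.restrict D] 0

/-! ### Mass ratios and concentration -/

/-- The `L²` norm over the set `s`. -/
def l2Norm {X : Type*} [MeasureSpace X] (s : Set X) (v : X → ℝ) : ℝ :=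
  (eLpNorm v 2 (volume.restrict s)).toReal

/-- The relative mass `R_W(v) = ‖v‖²_{L²(W)} / ‖v‖²_{L²(D)}`. -/
def relMass {X : Type*} [MeasureSpace X] (D W : Set X) (v : X → ℝ) : ℝ :=
  l2Norm W v ^ 2 / l2Norm D v ^ 2

/-- The sequence `φ` does not concentrate in `D \ W`: the relative masses in `W` have a positive
lower limit, i.e. `R_W` tends to `0` along no subsequence. -/
def NotConcentratingOutside {X : Type*} [MeasureSpace X] (D W : Set X) (φ : ℕ → X → ℝ) : Prop :=
  0 < liminf (fun k => relMass D W (φ k)) atTop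

/-! ### Coefficients -/

/-- Coefficients on `(0, H)`, essentially bounded below by `cm` and above by `cM`. -/
def Coeffs (H cm cM : ℝ) : Set (ℝ → ℝ) :=
  {c | AEMeasurable c (volume.restrict (Ioo 0 H)) ∧
    ∀ᵐ y ∂(volume.restrict (Ioo 0 H)), cm ≤ c y ∧ c y ≤ cM}

/-- Total variation on `(0, H)` of the `L^∞` class of `c`: the least variation of a function that
agrees with `c` almost everywhere. -/
def totalVar (H : ℝ) (c : ℝ → ℝ) : ℝ≥0∞ :=
  ⨅ (g : ℝ → ℝ) (_ : g =ᵐ[volume.restrict (Ioo 0 H)] c), eVariationOn g (Ioo 0 H)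

/-- Coefficients between `cm` and `cM` with total variation at most `V`. -/
def CoeffsV (H cm cM V : ℝ) : Set (ℝ → ℝ) :=
  {c | c ∈ Coeffs H cm cM ∧ totalVar H c ≤ ENNReal.ofReal V}

/-! ### The reduced operators `A_k = c (μ_k² - d²/dy²)` -/

/-- `u ∈ H²(0, H) ∩ H¹₀(0, H)` (given by its representative that is continuously differentiable on
`[0, H]`; its derivative is the primitive of the second weak derivative `w ∈ L²(0, H)`), and
`c (m² u - u'') = lam u` almost everywhere in `(0, H)`. -/
def SolvesReduced (H : ℝ) (c : ℝ → ℝ) (m lam : ℝ) (u : ℝ → ℝ) : Prop :=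
  ∃ w : ℝ → ℝ, MemLp w 2 (volume.restrict (Ioo 0 H)) ∧
    DifferentiableOn ℝ u (Icc 0 H) ∧
    (∀ y ∈ Icc 0 H,
      derivWithin u (Icc 0 H) y = derivWithin u (Icc 0 H) 0 + ∫ t in (0 : ℝ)..y, w t) ∧
    u 0 = 0 ∧ u H = 0 ∧
    ∀ᵐ y ∂(volume.restrict (Ioo 0 H)), c y * (m ^ 2 * u y - w y) = lam * u y

/-- `lam` is an eigenvalue of `c (m² - d²/dy²)`. -/
def IsReducedEigenvalue (H : ℝ) (c : ℝ → ℝ) (m lam : ℝ) : Prop :=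
  ∃ u, SolvesReduced H c m lam u ∧ ∃ y ∈ Icc 0 H, u y ≠ 0

/-- `u` is an eigenfunction for `lam`, normalized in `L²((0, H), c⁻¹ dy)`. -/
def IsNormalizedEigenfunction (H : ℝ) (c : ℝ → ℝ) (m lam : ℝ) (u : ℝ → ℝ) : Prop :=
  SolvesReduced H c m lam u ∧ ∫ y in (0 : ℝ)..H, u y ^ 2 * (c y)⁻¹ = 1

/-- The non-guided pairs: `lam` is an eigenvalue of `A_k` with
`lam ≥ (ess sup c + ε) μ_k²`. A pair is recorded by the index `k`, so that `φ_k` is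
determined also when `μ_k²` is a multiple eigenvalue. As the eigenvalues of `A_k` form an
increasing sequence, these are the ones from the first one above the threshold onwards. -/
def nonGuided (H ε : ℝ) (μ : ℕ → ℝ) (c : ℝ → ℝ) : Set (ℕ × ℝ) :=
  {p | IsReducedEigenvalue H c (μ p.1) p.2 ∧
    (essSup c (volume.restrict (Ioo 0 H)) + ε) * μ p.1 ^ 2 ≤ p.2}

/-- The squared minimal amplitude: the infimum of `u² + u'²` over `[0, H]` and over all normalized
eigenfunctions of non-guided pairs. -/
def minAmplitudeSq (H ε : ℝ) (μ : ℕ → ℝ) (c : ℝ → ℝ) : ℝ≥0∞ :=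
  ⨅ (p : ℕ × ℝ) (_ : p ∈ nonGuided H ε μ c) (u : ℝ → ℝ)
    (_ : IsNormalizedEigenfunction H c (μ p.1) p.2 u) (y : ℝ) (_ : y ∈ Icc 0 H),
    ENNReal.ofReal (u y ^ 2 + derivWithin u (Icc 0 H) y ^ 2)

/-- The minimal amplitude hypothesis. -/
def MinimalAmplitudeHypothesis (H ε : ℝ) (μ : ℕ → ℝ) (c : ℝ → ℝ) : Prop :=
  0 < minAmplitudeSq H ε μ c

end Layered

end

noncomputable section

namespace Layered

/-! ### Continuously differentiable functions whose derivative is absolutely continuous -/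

/-! The reduced equation is `u'' = -q u` with `q = lam / c - m²`. The non-guided threshold gives `q
≥ lam * κ` with `κ = ε / (cM (cM + ε))`, while the variation of `q` is at most `lam / cm²` times
that of `c`. The energy `u'² + q u²` can change across `(0, H)` at most by the exponential of
(variation of `q`) / (lower bound of `q`), and in this quotient `lam` cancels: the factor depends
only on `cm`, `cM`, `ε` and the variation bound. Hence the energy at any one point controls it
everywhere, and the normalization of `u` forces it to be at least a constant times `lam` at every
point. A nontrivial Dirichlet solution also has `lam ≥ cm / H²`, so `u² + u'²` is bounded below
uniformly. Testing the equation with a cutoff times `u` turns this pointwise bound into a lower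
bound for the mass in each subinterval. The carriers are `HasPrimitives.energy_le`,
`IsNormalizedEigenfunction.amplitude_bound` and `HasPrimitives.mass_bound`.

Since `q` may jump, its energy has no usable derivative. It is compared on short intervals with the
energy in which `q` is frozen; the error is a product of two small increments and disappears under
bisection.

For product functions the masses multiply, so the horizontal factor needs a uniform lower bound for
the mass of `φ k` in `W`. Nonconcentration covers all large `k`; for the finitely many others the
mass only has to be nonzero, which is unique continuation for the Helmholtz equation. That is proved
by testing with powers of linear forms times radial functions: a solution vanishing near the center
of a ball has, after a radial cutoff, only zero moments, and a compactly supported function with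
zero moments vanishes by its Fourier transform. -/

/-- `u` is continuously differentiable with derivative `p`, and `p` is a primitive of the
integrable function `w`. -/
structure HasPrimitives (u p w : ℝ → ℝ) : Prop where
  integrable : Integrable w
  hasDerivAt : ∀ y, HasDerivAt u (p y) y
  primitive : ∀ y, p y = p 0 + ∫ t in (0 : ℝ)..y, w t

namespace HasPrimitives

variable {u p w : ℝ → ℝ}

theorem continuous_deriv (h : HasPrimitives u p w) : Continuous p := by
  have : p = fun y => p 0 + ∫ t in (0 : ℝ)..y, w t := funext h.primitive
  rw [this]
  exact continuous_const.add
    (intervalIntegral.continuous_primitive (fun _ _ => h.integrable.intervalIntegrable) 0)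

theorem continuous (h : HasPrimitives u p w) : Continuous u :=
  continuous_iff_continuousAt.2 fun y => (h.hasDerivAt y).continuousAt

theorem ae_hasDerivAt (h : HasPrimitives u p w) : ∀ᵐ y, HasDerivAt p (w y) y := by
  filter_upwards [LocallyIntegrable.ae_hasDerivAt_integral h.integrable.locallyIntegrable] with y hy
  have : p = fun y => p 0 + ∫ t in (0 : ℝ)..y, w t := funext h.primitive
  rw [this]
  exact (hy 0).const_add _

theorem sub_eq_integral (h : HasPrimitives u p w) (s t : ℝ) : p t - p s = ∫ y in s..t, w y := by
  rw [h.primitive t, h.primitive s, add_sub_add_left_eq_sub,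
    intervalIntegral.integral_interval_sub_left] <;> exact h.integrable.intervalIntegrable

theorem absolutelyContinuous_deriv (h : HasPrimitives u p w) (s t : ℝ) :
    AbsolutelyContinuousOnInterval p s t := by
  have h1 := (h.integrable.intervalIntegrable (a := s) (b := t)
    ).absolutelyContinuousOnInterval_intervalIntegral (c := s) left_mem_uIcc
  have h2 : AbsolutelyContinuousOnInterval (fun _ : ℝ => p s) s t :=
    (contDiff_const (n := 1)).contDiffOn.absolutelyContinuousOnInterval
  have : p = fun y => p s + ∫ t in s..y, w t := by
    funext y
    rw [← h.sub_eq_integral]; ring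
  rw [this]
  exact h2.add h1

/-- Integration by parts against the derivative `p`. -/
theorem integral_deriv_mul_add {f f' : ℝ → ℝ} (h : HasPrimitives u p w)
    (hf : ∀ y, HasDerivAt f (f' y) y) (hf' : Continuous f') (s t : ℝ) :
    ∫ y in s..t, (f' y * p y + f y * w y) = f t * p t - f s * p s := by
  have hfac : AbsolutelyContinuousOnInterval f s t := by
    apply ContDiffOn.absolutelyContinuousOnInterval
    apply ContDiff.contDiffOn
    rw [contDiff_one_iff_deriv]
    refine ⟨fun y => (hf y).differentiableAt, ?_⟩
    have : deriv f = f' := funext fun y => (hf y).deriv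
    rwa [this]
  rw [← hfac.integral_deriv_mul_eq_sub (h.absolutelyContinuous_deriv s t)]
  apply intervalIntegral.integral_congr_ae
  filter_upwards [h.ae_hasDerivAt] with y hy _
  rw [hy.deriv, (hf y).deriv]

theorem integral_two_mul (h : HasPrimitives u p w) (s t : ℝ) :
    ∫ y in s..t, 2 * p y * w y = p t ^ 2 - p s ^ 2 := by
  have hac := h.absolutelyContinuous_deriv s t
  rw [pow_two, pow_two, ← hac.integral_deriv_mul_eq_sub hac]
  apply intervalIntegral.integral_congr_ae
  filter_upwards [h.ae_hasDerivAt] with y hy _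
  rw [hy.deriv]; ring

/-- Since `r` is constant, differentiation of the energy never falls on the coefficient. This is
what makes the frozen energy usable when the true coefficient is discontinuous. -/
theorem energy_sub (h : HasPrimitives u p w) (r s t : ℝ) :
    (p t ^ 2 + r * u t ^ 2) - (p s ^ 2 + r * u s ^ 2)
      = ∫ y in s..t, 2 * p y * (w y + r * u y) := by
  have h1 : ∫ y in s..t, 2 * r * u y * p y = r * u t ^ 2 - r * u s ^ 2 := by
    refine intervalIntegral.integral_eq_sub_of_hasDerivAt (f := fun y => r * u y ^ 2) (fun y _ => ?_) ?_
    · have := ((h.hasDerivAt y).pow 2).const_mul r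
      refine this.congr_deriv ?_
      push_cast; ring
    · exact (Continuous.mul (continuous_const.mul h.continuous)
        h.continuous_deriv).intervalIntegrable _ _
  have h2 := h.integral_two_mul s t
  have : ∫ y in s..t, 2 * p y * (w y + r * u y)
      = (∫ y in s..t, 2 * p y * w y) + ∫ y in s..t, 2 * r * u y * p y := by
    rw [← intervalIntegral.integral_add]
    · congr 1; funext y; ring
    · exact (h.integrable.intervalIntegrable (a := s) (b := t)).continuousOn_mul
        (continuous_const.mul h.continuous_deriv).continuousOn
    · exact (Continuous.mul (continuous_const.mul h.continuous)
        h.continuous_deriv).intervalIntegrable _ _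
  rw [this, h1, h2]; ring

/-- Change of the energy with frozen coefficient `r`, where `u'' = - q u`. -/
theorem abs_energy_sub_le (h : HasPrimitives u p w) {q : ℝ → ℝ} {a b s t r δ C : ℝ}
    (hq : ∀ᵐ y ∂(volume.restrict (Ioo a b)), w y = - q y * u y)
    (has : a ≤ s) (hst : s ≤ t) (htb : t ≤ b)
    (hδ : ∀ y ∈ Ioo s t, |r - q y| ≤ δ)
    (hC : ∀ y ∈ Icc a b, |2 * p y * u y| ≤ C) :
    |(p t ^ 2 + r * u t ^ 2) - (p s ^ 2 + r * u s ^ 2)| ≤ C * δ * (t - s) := by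
  rw [h.energy_sub r s t]
  have key : ‖∫ y in s..t, 2 * p y * (w y + r * u y)‖ ≤ (C * δ) * |t - s| := by
    apply intervalIntegral.norm_integral_le_of_norm_le_const_ae
    have hne : ∀ᵐ y : ℝ, y ≠ t := by
      simp [ae_iff]
    rw [ae_restrict_iff' measurableSet_Ioo] at hq
    filter_upwards [hq, hne] with y hy hyt hys
    rw [uIoc_of_le hst] at hys
    have hyo : y ∈ Ioo s t := ⟨hys.1, lt_of_le_of_ne hys.2 hyt⟩
    have hyab : y ∈ Ioo a b := ⟨has.trans_lt hyo.1, hyo.2.trans_le htb⟩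
    rw [hy hyab, show 2 * p y * (-q y * u y + r * u y) = (2 * p y * u y) * (r - q y) by ring,
      norm_mul]
    exact mul_le_mul (hC y (Ioo_subset_Icc_self hyab)) (hδ y hyo) (abs_nonneg _)
      ((abs_nonneg _).trans (hC y (Ioo_subset_Icc_self hyab)))
  rwa [Real.norm_eq_abs, abs_of_nonneg (sub_nonneg.2 hst)] at key

end HasPrimitives

/-! ### Energy comparison for a coefficient of bounded variation -/

/-- A function whose increments are bounded by products of the increments of two functions, one of
which is the identity, cannot increase. -/
theorem le_of_sub_le_mul_sub {L v : ℝ → ℝ} {a b C : ℝ} (hab : a ≤ b)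
    (h : ∀ s ∈ Icc a b, ∀ t ∈ Icc a b, s ≤ t → L t - L s ≤ C * (t - s) * (v t - v s)) :
    L b ≤ L a := by
  -- Splitting at the midpoint halves the factor `t - s`, while the increments of `v` add up; so
  -- each bisection halves the constant.
  have key : ∀ n : ℕ, ∀ s ∈ Icc a b, ∀ t ∈ Icc a b, s ≤ t →
      L t - L s ≤ C / 2 ^ n * (t - s) * (v t - v s) := by
    intro n
    induction n with
    | zero => simpa using h
    | succ n ih =>
      intro s hs t ht hst
      have hm : (s + t) / 2 ∈ Icc a b := ⟨by linarith [hs.1, ht.1], by linarith [hs.2, ht.2]⟩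
      have h1 := ih s hs _ hm (by linarith)
      have h2 := ih _ hm t ht (by linarith)
      have : C / 2 ^ (n + 1) * (t - s) * (v t - v s)
          = C / 2 ^ n * ((s + t) / 2 - s) * (v ((s + t) / 2) - v s)
            + C / 2 ^ n * (t - (s + t) / 2) * (v t - v ((s + t) / 2)) := by
        rw [pow_succ]; field_simp; ring
      linarith
  have hlim : Tendsto (fun n : ℕ => C / 2 ^ n * (b - a) * (v b - v a)) atTop (nhds 0) := by
    have h2 : Tendsto (fun n : ℕ => C * (1 / 2 : ℝ) ^ n * (b - a) * (v b - v a)) atTop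
        (nhds (C * 0 * (b - a) * (v b - v a))) :=
      (((tendsto_pow_atTop_nhds_zero_of_lt_one (by norm_num) (by norm_num)).const_mul
        C).mul_const _).mul_const _
    simpa [div_eq_mul_inv] using h2
  have := ge_of_tendsto' hlim fun n => key n a (left_mem_Icc.2 hab) b (right_mem_Icc.2 hab) hab
  linarith

/-- The energy `u'² + q u²` of a solution of `u'' = - q u` changes at most by a factor that depends
only on the variation of `q` relative to its lower bound. -/
theorem HasPrimitives.energy_le {u p w q v : ℝ → ℝ} (h : HasPrimitives u p w) {a b q₀ Λ : ℝ}
    (hab : a ≤ b) (hq : ∀ᵐ y ∂(volume.restrict (Ioo a b)), w y = - q y * u y)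
    (hq₀ : 0 < q₀) (hqq : ∀ y ∈ Icc a b, q₀ ≤ q y) (hΛ : 0 ≤ Λ)
    (hv : ∀ s ∈ Icc a b, ∀ t ∈ Icc a b, s ≤ t → |q t - q s| ≤ Λ * (v t - v s)) :
    p b ^ 2 + q b * u b ^ 2 ≤ Real.exp (Λ / q₀ * (v b - v a)) * (p a ^ 2 + q a * u a ^ 2) ∧
    p a ^ 2 + q a * u a ^ 2 ≤ Real.exp (Λ / q₀ * (v b - v a)) * (p b ^ 2 + q b * u b ^ 2) := by
  obtain ⟨C, hC⟩ : ∃ C, ∀ y ∈ Icc a b, |2 * p y * u y| ≤ C := by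
    have := isCompact_Icc (a := a) (b := b) |>.exists_bound_of_continuousOn
      (f := fun y => 2 * p y * u y)
      ((continuous_const.mul h.continuous_deriv).mul h.continuous).continuousOn
    simpa using this
  have hC0 : 0 ≤ C := (abs_nonneg _).trans (hC a (left_mem_Icc.2 hab))
  have hΛv : ∀ s ∈ Icc a b, ∀ t ∈ Icc a b, s ≤ t → 0 ≤ Λ * (v t - v s) := fun s hs t ht hst =>
    (abs_nonneg _).trans (hv s hs t ht hst)
  -- `q x ≤ q y + d ≤ (1 + d / q₀) q y`, and `1 + z ≤ exp z`. The exponential form makes successive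
  -- changes of coefficient multiply into the total increment of `v`.
  have hrate : ∀ x ∈ Icc a b, ∀ y ∈ Icc a b, ∀ d, 0 ≤ d → |q x - q y| ≤ d →
      q x ≤ Real.exp (d / q₀) * q y := by
    intro x hx y hy d hd hxy
    have h1 := Real.add_one_le_exp (d / q₀)
    have h2 : d ≤ d / q₀ * q y := by
      rw [div_mul_eq_mul_div, le_div_iff₀ hq₀]
      exact mul_le_mul_of_nonneg_left (hqq y hy) hd
    have h3 := mul_le_mul_of_nonneg_right h1 (hq₀.le.trans (hqq y hy))
    linarith [(abs_le.1 hxy).2]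
  have hen : ∀ z, ∀ x ∈ Icc a b, ∀ y ∈ Icc a b, ∀ d, 0 ≤ d → |q x - q y| ≤ d →
      p z ^ 2 + q x * u z ^ 2 ≤ Real.exp (d / q₀) * (p z ^ 2 + q y * u z ^ 2) := by
    intro z x hx y hy d hd hxy
    have h1 := mul_le_mul_of_nonneg_right (hrate x hx y hy d hd hxy) (sq_nonneg (u z))
    have h2 : 1 ≤ Real.exp (d / q₀) := Real.one_le_exp (by positivity)
    have h3 := mul_le_mul_of_nonneg_right h2 (sq_nonneg (p z))
    linarith
  have hfr : ∀ s ∈ Icc a b, ∀ t ∈ Icc a b, s ≤ t → ∀ x ∈ Icc s t,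
      |(p t ^ 2 + q x * u t ^ 2) - (p s ^ 2 + q x * u s ^ 2)|
        ≤ C * (Λ * (v t - v s)) * (t - s) := by
    intro s hs t ht hst x hx
    have hmem : ∀ y ∈ Icc s t, y ∈ Icc a b := fun y hy => ⟨hs.1.trans hy.1, hy.2.trans ht.2⟩
    refine h.abs_energy_sub_le hq hs.1 hst ht.2 (fun y hy => ?_) hC
    have hy' := Ioo_subset_Icc_self hy
    rcases le_total x y with hxy | hxy
    · rw [abs_sub_comm]
      have h1 := hv x (hmem x hx) y (hmem y hy') hxy
      have h2 := hΛv s hs x (hmem x hx) hx.1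
      have h3 := hΛv y (hmem y hy') t ht hy'.2
      linarith
    · have h1 := hv y (hmem y hy') x (hmem x hx) hxy
      have h2 := hΛv s hs y (hmem y hy') hy'.1
      have h3 := hΛv x (hmem x hx) t ht hx.2
      linarith
  set K := Λ / q₀ with hK
  have hK0 : 0 ≤ K := by positivity
  have hvm : ∀ s ∈ Icc a b, ∀ t ∈ Icc a b, s ≤ t → 0 ≤ K * (v t - v s) := by
    intro s hs t ht hst
    rw [hK, div_mul_eq_mul_div]
    exact div_nonneg (hΛv s hs t ht hst) hq₀.le
  have hdiv : ∀ s t, Λ * (v t - v s) / q₀ = K * (v t - v s) := fun s t => by rw [hK]; ring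
  have ha := left_mem_Icc.2 hab
  have hb := right_mem_Icc.2 hab
  constructor
  -- The exponential weight absorbs the cost of changing the frozen coefficient from `q s` to `q t`,
  -- so only the second order error of the frozen energy remains.
  · have key := le_of_sub_le_mul_sub (L := fun t => Real.exp (-(K * (v t - v a))) *
      (p t ^ 2 + q t * u t ^ 2)) (v := v) (C := C * Λ) hab ?_
    · simp only [sub_self, mul_zero, neg_zero, Real.exp_zero, one_mul, Real.exp_neg] at key
      rwa [inv_mul_le_iff₀ (Real.exp_pos _)] at key
    · intro s hs t ht hst
      have h1 := hen t t ht s hs _ (hΛv s hs t ht hst) (hv s hs t ht hst)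
      have h2 := (abs_le.1 (hfr s hs t ht hst s (left_mem_Icc.2 hst))).2
      rw [hdiv] at h1
      have h3 := mul_le_mul_of_nonneg_left h1 (Real.exp_pos (-(K * (v t - v a)))).le
      rw [← mul_assoc, ← Real.exp_add, show -(K * (v t - v a)) + K * (v t - v s)
        = -(K * (v s - v a)) by ring] at h3
      have h4 : Real.exp (-(K * (v s - v a))) ≤ 1 :=
        Real.exp_le_one_iff.2 (neg_nonpos.2 (hvm a ha s hs hs.1))
      have h5 := mul_le_mul_of_nonneg_left h2 (Real.exp_pos (-(K * (v s - v a)))).le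
      have h6 : 0 ≤ C * (Λ * (v t - v s)) * (t - s) :=
        mul_nonneg (mul_nonneg hC0 (hΛv s hs t ht hst)) (by linarith)
      have h7 := mul_le_mul_of_nonneg_right h4 h6
      linarith
  -- The reverse bound: the weight is now anchored at `b`, and the coefficient is frozen at the
  -- right end of each subinterval.
  · have key := le_of_sub_le_mul_sub (L := fun t => -(Real.exp (-(K * (v b - v t))) *
      (p t ^ 2 + q t * u t ^ 2))) (v := v) (C := C * Λ) hab ?_
    · simp only [sub_self, mul_zero, neg_zero, Real.exp_zero, one_mul, Real.exp_neg,
        neg_le_neg_iff] at key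
      rwa [inv_mul_le_iff₀ (Real.exp_pos _)] at key
    · intro s hs t ht hst
      have h1 := hen s s hs t ht _ (hΛv s hs t ht hst) (by
        rw [abs_sub_comm]; exact hv s hs t ht hst)
      have h2 := (abs_le.1 (hfr s hs t ht hst t (right_mem_Icc.2 hst))).1
      rw [hdiv] at h1
      have h3 := mul_le_mul_of_nonneg_left h1 (Real.exp_pos (-(K * (v b - v s)))).le
      rw [← mul_assoc, ← Real.exp_add, show -(K * (v b - v s)) + K * (v t - v s)
        = -(K * (v b - v t)) by ring] at h3
      have h4 : Real.exp (-(K * (v b - v t))) ≤ 1 :=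
        Real.exp_le_one_iff.2 (neg_nonpos.2 (hvm t ht b hb ht.2))
      have h5 := mul_le_mul_of_nonneg_left h2 (Real.exp_pos (-(K * (v b - v t)))).le
      have h6 : 0 ≤ C * (Λ * (v t - v s)) * (t - s) :=
        mul_nonneg (mul_nonneg hC0 (hΛv s hs t ht hst)) (by linarith)
      have h7 := mul_le_mul_of_nonneg_right h4 h6
      linarith

/-! ### Solutions of the reduced Dirichlet problem -/

/-- A solution of the reduced problem extends to a function with primitives on the whole line. -/
theorem SolvesReduced.exists_hasPrimitives {H : ℝ} (hH : 0 < H) {c : ℝ → ℝ} {m lam : ℝ} {u : ℝ → ℝ}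
    (hu : SolvesReduced H c m lam u) (hc : ∀ᵐ y ∂(volume.restrict (Ioo 0 H)), c y ≠ 0) :
    ∃ U p w, HasPrimitives U p w ∧ EqOn U u (Icc 0 H) ∧
      EqOn p (derivWithin u (Icc 0 H)) (Icc 0 H) ∧ U 0 = 0 ∧ U H = 0 ∧
      ∀ᵐ y ∂(volume.restrict (Ioo 0 H)), w y = - (lam / c y - m ^ 2) * U y := by
  obtain ⟨w₀, hw₀, hd, hder, hu0, huH, heq⟩ := hu
  -- Extension of `w₀` by zero makes the solution affine outside `[0, H]`, so derivatives on the
  -- line replace one-sided ones.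
  set w := (Ioo 0 H).indicator w₀ with hw
  have hwi : Integrable w := by
    rw [hw, integrable_indicator_iff measurableSet_Ioo]
    exact hw₀.integrable one_le_two
  set p₀ := derivWithin u (Icc 0 H) 0 with hp₀
  set p : ℝ → ℝ := fun y => p₀ + ∫ t in (0 : ℝ)..y, w t with hp
  have hpc : Continuous p := continuous_const.add
    (intervalIntegral.continuous_primitive (fun _ _ => hwi.intervalIntegrable) 0)
  have hpe : EqOn p (derivWithin u (Icc 0 H)) (Icc 0 H) := by
    intro y hy
    rw [hder y hy, hp]
    dsimp only
    congr 1
    apply intervalIntegral.integral_congr_ae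
    have hne : ∀ᵐ x : ℝ, x ≠ H := by simp [ae_iff]
    filter_upwards [hne] with x hx hxy
    rw [uIoc_of_le hy.1] at hxy
    rw [hw, indicator_of_mem]
    exact ⟨hxy.1, lt_of_le_of_ne (hxy.2.trans hy.2) hx⟩
  set U : ℝ → ℝ := fun y => ∫ t in (0 : ℝ)..y, p t with hU
  have hUu : EqOn U u (Icc 0 H) := by
    intro y hy
    have := intervalIntegral.integral_eq_sub_of_hasDeriv_right_of_le (f := u) (f' := p) hy.1
      (hd.continuousOn.mono (Icc_subset_Icc_right hy.2)) (fun x hx => ?_)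
      (hpc.intervalIntegrable _ _)
    · rw [hU]; dsimp only; rw [this, hu0, sub_zero]
    · have hx' : x ∈ Icc 0 H := ⟨hx.1.le, hx.2.le.trans hy.2⟩
      have h1 := (hd x hx').hasDerivWithinAt
      rw [← hpe hx'] at h1
      exact (h1.hasDerivAt (Icc_mem_nhds hx.1 (hx.2.trans_le hy.2))).hasDerivWithinAt
  refine ⟨U, p, w, ⟨hwi, fun y => ?_, fun y => ?_⟩, hUu, hpe, ?_, ?_, ?_⟩
  · exact intervalIntegral.integral_hasDerivAt_right (hpc.intervalIntegrable _ _)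
      (hpc.stronglyMeasurableAtFilter _ _) hpc.continuousAt
  · simp [hp]
  · simp [hU]
  · rw [hUu (right_mem_Icc.2 hH.le), huH]
  · filter_upwards [heq, hc, ae_restrict_mem measurableSet_Ioo] with y hy hcy hyI
    rw [hUu (Ioo_subset_Icc_self hyI), hw, indicator_of_mem hyI]
    field_simp
    linarith

/-- A nonzero solution of `u'' = - q u` with Dirichlet conditions forces `q` to be large. -/
theorem HasPrimitives.one_le_of_ne_zero {u p w q : ℝ → ℝ} (h : HasPrimitives u p w) {H Q : ℝ}
    (hH : 0 < H) (h0 : u 0 = 0) (h1 : u H = 0)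
    (hq : ∀ᵐ y ∂(volume.restrict (Ioo 0 H)), w y = - q y * u y)
    (hQ : ∀ y, |q y| ≤ Q) (hne : ∃ y ∈ Icc 0 H, u y ≠ 0) : 1 ≤ Q * H ^ 2 := by
  obtain ⟨y₀, hy₀, huy₀⟩ := hne
  obtain ⟨z, hz, hzmax⟩ := isCompact_Icc.exists_isMaxOn (nonempty_Icc.2 hH.le)
    (f := fun y => |u y|) h.continuous.abs.continuousOn
  have hM : 0 < |u z| := (abs_pos.2 huy₀).trans_le (hzmax hy₀)
  have hQ0 : 0 ≤ Q := (abs_nonneg _).trans (hQ 0)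
  -- Rolle's theorem gives a zero of `p`. Integrating `u''` from it bounds `|p|` by `Q H max |u|`,
  -- and integrating `p` from `0` bounds `max |u|` by `Q H² max |u|`.
  obtain ⟨t₀, ht₀, hpt₀⟩ := exists_hasDerivAt_eq_zero hH h.continuous.continuousOn
    (h0.trans h1.symm) fun y _ => h.hasDerivAt y
  have hpb : ∀ y ∈ Icc 0 H, ‖p y‖ ≤ Q * |u z| * H := by
    intro y hy
    have h2 := h.sub_eq_integral t₀ y
    rw [hpt₀, sub_zero] at h2
    rw [h2]
    refine (intervalIntegral.norm_integral_le_of_norm_le_const_ae (C := Q * |u z|) ?_).trans ?_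
    · have hne : ∀ᵐ x : ℝ, x ≠ H := by simp [ae_iff]
      rw [ae_restrict_iff' measurableSet_Ioo] at hq
      filter_upwards [hq, hne] with x hx hxH hxm
      have hx' : x ∈ Ioc 0 H := by
        rcases mem_uIoc.1 hxm with h3 | h3
        · exact ⟨ht₀.1.trans h3.1, h3.2.trans hy.2⟩
        · exact ⟨hy.1.trans_lt h3.1, h3.2.trans ht₀.2.le⟩
      rw [hx ⟨hx'.1, lt_of_le_of_ne hx'.2 hxH⟩, norm_mul, norm_neg]
      exact mul_le_mul (hQ x) (hzmax ⟨hx'.1.le, hx'.2⟩) (abs_nonneg _) hQ0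
    · refine mul_le_mul_of_nonneg_left ?_ (by positivity)
      rw [abs_le]
      constructor <;> linarith [hy.1, hy.2, ht₀.1, ht₀.2]
  have h3 := (convex_Icc 0 H).norm_image_sub_le_of_norm_hasDerivWithin_le
    (fun y _ => (h.hasDerivAt y).hasDerivWithinAt) hpb (left_mem_Icc.2 hH.le) hz
  rw [h0, sub_zero, sub_zero, Real.norm_eq_abs, Real.norm_eq_abs, abs_of_nonneg hz.1] at h3
  have h4 : Q * |u z| * H * z ≤ Q * |u z| * H * H :=
    mul_le_mul_of_nonneg_left hz.2 (by positivity)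
  have h5 : 1 * |u z| ≤ Q * H ^ 2 * |u z| := by nlinarith
  exact le_of_mul_le_mul_right h5 hM

/-! ### Coefficients of bounded variation -/

/-- The variation bound `V + 1` leaves room to pick a representative without knowing that the
infimum is attained. Truncation to `[cm, S]` is 1-Lipschitz, so it does not increase the variation,
and it makes the bounds hold everywhere, as the pointwise energy requires. -/
theorem exists_bounded_representative {H cm V S : ℝ} {c : ℝ → ℝ}
    (hc : ∀ᵐ y ∂(volume.restrict (Ioo 0 H)), cm ≤ c y ∧ c y ≤ S) (hS : cm ≤ S)
    (hV : totalVar H c ≤ ENNReal.ofReal V) (hV0 : 0 ≤ V) :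
    ∃ g : ℝ → ℝ, g =ᵐ[volume.restrict (Ioo 0 H)] c ∧ (∀ y, cm ≤ g y ∧ g y ≤ S) ∧
      eVariationOn g (Ioo 0 H) ≤ ENNReal.ofReal (V + 1) := by
  have hlt : totalVar H c < ENNReal.ofReal (V + 1) :=
    hV.trans_lt ((ENNReal.ofReal_lt_ofReal_iff (by linarith)).2 (by linarith))
  obtain ⟨g, hg⟩ := iInf_lt_iff.1 hlt
  obtain ⟨hgc, hgV⟩ := iInf_lt_iff.1 hg
  have hlip : LipschitzWith 1 fun x : ℝ => max cm (min S x) :=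
    (LipschitzWith.id.const_min S).const_max cm
  refine ⟨(fun x : ℝ => max cm (min S x)) ∘ g, ?_, fun y => ?_, ?_⟩
  · filter_upwards [hgc, hc] with y hy hcy
    simp [hy, hcy.1, hcy.2]
  · simp [hS]
  · refine ((hlip.lipschitzOnWith (s := univ)).comp_eVariationOn_le (mapsTo_univ _ _)).trans ?_
    simpa using hgV.le

/-- The energy comparison for `u'' = - (lam / g - m²) u`, where `g` has bounded variation. -/
theorem HasPrimitives.reduced_energy_le {u p w g : ℝ → ℝ} (h : HasPrimitives u p w)
    {H cm V κ lam m : ℝ} (hcm : 0 < cm) (hV : 0 ≤ V) (hκ : 0 < κ) (hlam : 0 < lam)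
    (hg : ∀ y, cm ≤ g y) (hgV : eVariationOn g (Ioo 0 H) ≤ ENNReal.ofReal V)
    (hq : ∀ᵐ y ∂(volume.restrict (Ioo 0 H)), w y = - (lam / g y - m ^ 2) * u y)
    (hqκ : ∀ y, lam * κ ≤ lam / g y - m ^ 2) {s t : ℝ} (hs : s ∈ Ioo 0 H) (ht : t ∈ Ioo 0 H) :
    p s ^ 2 + (lam / g s - m ^ 2) * u s ^ 2
      ≤ Real.exp (V / (cm ^ 2 * κ)) * (p t ^ 2 + (lam / g t - m ^ 2) * u t ^ 2) := by
  have hloc : LocallyBoundedVariationOn g (Ioo 0 H) :=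
    BoundedVariationOn.locallyBoundedVariationOn (ne_top_of_le_ne_top ENNReal.ofReal_ne_top hgV)
  have main : ∀ a ∈ Ioo 0 H, ∀ b ∈ Ioo 0 H, a ≤ b →
      p b ^ 2 + (lam / g b - m ^ 2) * u b ^ 2
        ≤ Real.exp (V / (cm ^ 2 * κ)) * (p a ^ 2 + (lam / g a - m ^ 2) * u a ^ 2) ∧
      p a ^ 2 + (lam / g a - m ^ 2) * u a ^ 2
        ≤ Real.exp (V / (cm ^ 2 * κ)) * (p b ^ 2 + (lam / g b - m ^ 2) * u b ^ 2) := by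
    intro a ha b hb hab
    have hsub : ∀ y ∈ Icc a b, y ∈ Ioo 0 H := fun y hy =>
      ⟨ha.1.trans_le hy.1, hy.2.trans_lt hb.2⟩
    have hκl : 0 < lam * κ := by positivity
    -- `lam / cm ^ 2` is a Lipschitz constant of `x ↦ lam / x` on `[cm, ∞)`, and the control
    -- function is the variation of `g` from `a`.
    have key := h.energy_le (q := fun y => lam / g y - m ^ 2) (q₀ := lam * κ) (Λ := lam / cm ^ 2)
      (v := fun y => variationOnFromTo g (Ioo 0 H) a y) hab
      (ae_restrict_of_ae_restrict_of_subset (Ioo_subset_Ioo ha.1.le hb.2.le) hq)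
      hκl (fun y _ => hqκ y) (by positivity) ?_
    · have hexp : Real.exp (lam / cm ^ 2 / (lam * κ) * (variationOnFromTo g (Ioo 0 H) a b
          - variationOnFromTo g (Ioo 0 H) a a)) ≤ Real.exp (V / (cm ^ 2 * κ)) := by
        rw [Real.exp_le_exp, variationOnFromTo.self, sub_zero]
        have h1 : variationOnFromTo g (Ioo 0 H) a b ≤ V := by
          rw [variationOnFromTo.eq_of_le _ _ hab]
          exact ENNReal.toReal_le_of_le_ofReal hV
            ((eVariationOn.mono _ inter_subset_left).trans hgV)
        -- The spectral parameter cancels here, which gives uniformity over all non-guided pairs.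
        have h2 : lam / cm ^ 2 / (lam * κ) = 1 / (cm ^ 2 * κ) := by field_simp
        rw [h2, div_mul_eq_mul_div, one_mul]
        gcongr
      have hnn : ∀ y, 0 ≤ p y ^ 2 + (lam / g y - m ^ 2) * u y ^ 2 := fun y =>
        add_nonneg (sq_nonneg _) (mul_nonneg (hκl.le.trans (hqκ y)) (sq_nonneg _))
      exact ⟨key.1.trans (mul_le_mul_of_nonneg_right hexp (hnn a)),
        key.2.trans (mul_le_mul_of_nonneg_right hexp (hnn b))⟩
    · intro x hx y hy hxy
      have hx' := hsub x hx
      have hy' := hsub y hy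
      have hadd := variationOnFromTo.add hloc ha hx' hy'
      have h1 : |g y - g x| ≤ variationOnFromTo g (Ioo 0 H) x y := by
        rw [variationOnFromTo.eq_of_le _ _ hxy, ← Real.dist_eq, dist_edist]
        refine ENNReal.toReal_mono (hloc x y hx' hy') ?_
        exact eVariationOn.edist_le _ ⟨hy', hxy, le_rfl⟩ ⟨hx', le_rfl, hxy⟩
      have hgx := hcm.trans_le (hg x)
      have hgy := hcm.trans_le (hg y)
      have h2 : |lam / g y - m ^ 2 - (lam / g x - m ^ 2)| = lam / (g x * g y) * |g y - g x| := by
        rw [show lam / g y - m ^ 2 - (lam / g x - m ^ 2) = lam / (g x * g y) * -(g y - g x) by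
          field_simp; ring, abs_mul, abs_neg, abs_of_pos (by positivity)]
      have h3 : lam / (g x * g y) ≤ lam / cm ^ 2 := by
        rw [pow_two]
        gcongr <;> apply hg
      rw [h2, show variationOnFromTo g (Ioo 0 H) a y - variationOnFromTo g (Ioo 0 H) a x
        = variationOnFromTo g (Ioo 0 H) x y by linarith]
      gcongr
  rcases le_total s t with hst | hst
  · exact (main s hs t ht hst).2
  · exact (main t ht s hs hst).1

/-- The real-valued `essSup` avoids its default value because `c` is essentially bounded and `(0,
H)` has positive measure. -/
theorem essSup_bounds {H cm cM : ℝ} (hH : 0 < H) {c : ℝ → ℝ} (hc : c ∈ Coeffs H cm cM) :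
    cm ≤ essSup c (volume.restrict (Ioo 0 H)) ∧ essSup c (volume.restrict (Ioo 0 H)) ≤ cM ∧
      ∀ᵐ y ∂(volume.restrict (Ioo 0 H)), cm ≤ c y ∧ c y ≤ essSup c (volume.restrict (Ioo 0 H)) := by
  have hne : NeBot (ae (volume.restrict (Ioo 0 H))) := by
    rw [ae_neBot, Ne, Measure.restrict_eq_zero, Real.volume_Ioo]
    simp [hH]
  have hb : IsBoundedUnder (· ≤ ·) (ae (volume.restrict (Ioo 0 H))) c :=
    ⟨cM, by simpa using hc.2.mono fun y hy => hy.2⟩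
  have hbb : IsBoundedUnder (· ≥ ·) (ae (volume.restrict (Ioo 0 H))) c :=
    ⟨cm, by simpa using hc.2.mono fun y hy => hy.1⟩
  have hle := ae_le_essSup hb
  refine ⟨?_, ?_, hc.2.mp (hle.mono fun y hy hy' => ⟨hy'.1, hy⟩)⟩
  · obtain ⟨y, hy, hy'⟩ := (hle.and hc.2).exists
    exact hy'.1.trans hy
  · exact limsup_le_of_le hbb.isCoboundedUnder_le (hc.2.mono fun y hy => hy.2)

/-! ### Uniform lower bound for the amplitude -/

/-- The constant in the lower bound for the amplitude. -/
def amplitudeConst (H cm cM ε V : ℝ) : ℝ :=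
  cm * (ε / (cM * (cM + ε))) /
    (H * Real.exp ((V + 1) / (cm ^ 2 * (ε / (cM * (cM + ε))))))

theorem amplitudeConst_pos {H cm cM ε V : ℝ} (hH : 0 < H) (hcm : 0 < cm) (hcM : cm < cM)
    (hε : 0 < ε) : 0 < amplitudeConst H cm cM ε V := by
  have : 0 < cM := hcm.trans hcM
  unfold amplitudeConst
  positivity

/-- Normalized eigenfunctions of non-guided pairs: the eigenvalue is bounded below and the
amplitude is uniformly bounded below. -/
theorem IsNormalizedEigenfunction.amplitude_bound {H cm cM ε V : ℝ} (hH : 0 < H) (hcm : 0 < cm)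
    (hcM : cm < cM) (hε : 0 < ε) (hV : 0 ≤ V) {c : ℝ → ℝ} (hc : c ∈ CoeffsV H cm cM V)
    {m lam : ℝ} (hlam : (essSup c (volume.restrict (Ioo 0 H)) + ε) * m ^ 2 ≤ lam) {u : ℝ → ℝ}
    (hu : IsNormalizedEigenfunction H c m lam u) :
    cm / H ^ 2 ≤ lam ∧ ∃ U p w q : ℝ → ℝ, HasPrimitives U p w ∧ EqOn U u (Icc 0 H) ∧
      EqOn p (derivWithin u (Icc 0 H)) (Icc 0 H) ∧
      (∀ᵐ y ∂(volume.restrict (Ioo 0 H)), w y = - q y * U y) ∧ (∀ y, q y ≤ lam / cm) ∧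
      ∀ y ∈ Icc 0 H, lam * amplitudeConst H cm cM ε V ≤ p y ^ 2 + lam / cm * U y ^ 2 := by
  obtain ⟨hS1, hS2, hcS⟩ := essSup_bounds hH hc.1
  set S := essSup c (volume.restrict (Ioo 0 H)) with hS
  have hcM0 : 0 < cM := hcm.trans hcM
  have hS0 : 0 < S := hcm.trans_le hS1
  obtain ⟨U, p, w, hP, hUu, hpu, hU0, hUH, hw⟩ := hu.1.exists_hasPrimitives hH
    (hcS.mono fun y hy => (hcm.trans_le hy.1).ne')
  obtain ⟨g, hgc, hgb, hgV⟩ := exists_bounded_representative hcS hS1 hc.2 hV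
  have hwg : ∀ᵐ y ∂(volume.restrict (Ioo 0 H)), w y = - (lam / g y - m ^ 2) * U y := by
    filter_upwards [hw, hgc] with y hy hgy
    rw [hgy, hy]
  set κ := ε / (cM * (cM + ε)) with hκ
  have hκ0 : 0 < κ := by positivity
  have hlam0 : 0 ≤ lam := le_trans (by positivity) hlam
  -- The gap `ε` enters here: `lam / g - m²` is at least `lam / S - lam / (S + ε)`, and `S ≤ cM`.
  have hqlow : ∀ y, lam * κ ≤ lam / g y - m ^ 2 := by
    intro y
    have hgy := hcm.trans_le (hgb y).1
    have h1 : m ^ 2 ≤ lam / (S + ε) := by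
      rw [le_div_iff₀ (by positivity)]; linarith
    have h2 : lam / S ≤ lam / g y := by
      gcongr; exact (hgb y).2
    have h3 : lam / S - lam / (S + ε) = lam * (ε / (S * (S + ε))) := by field_simp; ring
    have h4 : lam * κ ≤ lam * (ε / (S * (S + ε))) := by
      rw [hκ]; gcongr
    linarith
  have hqup : ∀ y, lam / g y - m ^ 2 ≤ lam / cm := by
    intro y
    have : lam / g y ≤ lam / cm := by gcongr; exact (hgb y).1
    linarith [sq_nonneg m]
  have hnz : ∃ y ∈ Icc 0 H, U y ≠ 0 := by
    by_contra! hcon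
    have : ∫ y in (0 : ℝ)..H, u y ^ 2 * (c y)⁻¹ = 0 := by
      refine (intervalIntegral.integral_congr (g := fun _ => (0 : ℝ)) ?_).trans
        intervalIntegral.integral_zero
      intro y hy
      rw [uIcc_of_le hH.le] at hy
      simp [← hUu hy, hcon y hy]
    rw [hu.2] at this
    exact one_ne_zero this
  have hlow := hP.one_le_of_ne_zero hH hU0 hUH hwg
    (Q := lam / cm) (fun y => abs_le.2 ⟨by
      have : 0 ≤ lam * κ := by positivity
      have h2 : 0 ≤ lam / cm := by positivity
      linarith [hqlow y], hqup y⟩) hnz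
  have hlamlow : cm / H ^ 2 ≤ lam := by
    rw [div_le_iff₀ (by positivity)]
    rw [div_mul_eq_mul_div, le_div_iff₀ hcm] at hlow
    linarith
  have hlampos : 0 < lam := lt_of_lt_of_le (by positivity) hlamlow
  refine ⟨hlamlow, U, p, w, fun y => lam / g y - m ^ 2, hP, hUu, hpu, hwg, hqup, ?_⟩
  have hcomp := fun s hs t ht => hP.reduced_energy_le (s := s) (t := t) hcm
    (by linarith : (0:ℝ) ≤ V + 1) hκ0 hlampos (fun y => (hgb y).1) hgV hwg hqlow hs ht
  set K := Real.exp ((V + 1) / (cm ^ 2 * κ)) with hK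
  have hK0 : 0 < K := Real.exp_pos _
  have hint : ∀ t ∈ Ioo 0 H, lam * amplitudeConst H cm cM ε V
      ≤ p t ^ 2 + (lam / g t - m ^ 2) * U t ^ 2 := by
    intro t ht
    set E := p t ^ 2 + (lam / g t - m ^ 2) * U t ^ 2 with hE
    have hE0 : 0 ≤ E := add_nonneg (sq_nonneg _)
      (mul_nonneg (le_trans (by positivity) (hqlow t)) (sq_nonneg _))
    -- Energy comparison bounds `U²` everywhere by the energy at the single point `t`; inserting
    -- this into the normalization integral bounds `E` from below.
    have hUb : ∀ s ∈ Ioo 0 H, U s ^ 2 ≤ K * E / (lam * κ) := by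
      intro s hs
      rw [le_div_iff₀ (by positivity)]
      have h1 := hcomp s hs t ht
      have h2 := mul_le_mul_of_nonneg_right (hqlow s) (sq_nonneg (U s))
      linarith [sq_nonneg (p s)]
    have hnorm : ‖∫ y in (0 : ℝ)..H, u y ^ 2 * (c y)⁻¹‖ ≤ K * E / (lam * κ) * cm⁻¹ * |H - 0| := by
      apply intervalIntegral.norm_integral_le_of_norm_le_const_ae
      have hne : ∀ᵐ x : ℝ, x ≠ H := by simp [ae_iff]
      have hcS' := hcS
      rw [ae_restrict_iff' measurableSet_Ioo] at hcS'
      filter_upwards [hne, hcS'] with y hyH hcy hy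
      rw [uIoc_of_le hH.le] at hy
      have hyI : y ∈ Ioo 0 H := ⟨hy.1, lt_of_le_of_ne hy.2 hyH⟩
      have hcy0 := hcm.trans_le (hcy hyI).1
      rw [Real.norm_of_nonneg (by positivity), ← hUu (Ioo_subset_Icc_self hyI)]
      exact mul_le_mul (hUb y hyI) (inv_anti₀ hcm (hcy hyI).1) (by positivity) (by positivity)
    rw [hu.2, norm_one, sub_zero, abs_of_pos hH] at hnorm
    unfold amplitudeConst
    rw [← hκ, ← hK, mul_div_assoc', div_le_iff₀ (by positivity)]
    have h5 : K * E / (lam * κ) * cm⁻¹ * H = (E * (H * K)) / (lam * (cm * κ)) := by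
      field_simp
    rw [h5, le_div_iff₀ (by positivity)] at hnorm
    linarith
  -- Replacing the possibly discontinuous coefficient by its upper bound `lam / cm` makes the
  -- expression continuous, so the bound extends to the endpoints.
  have hcl : Icc 0 H ⊆ {y | lam * amplitudeConst H cm cM ε V ≤ p y ^ 2 + lam / cm * U y ^ 2} := by
    rw [← closure_Ioo hH.ne]
    refine closure_minimal (fun y hy => ?_) (isClosed_le continuous_const
      ((hP.continuous_deriv.pow 2).add (continuous_const.mul (hP.continuous.pow 2))))
    have h1 := hint y hy
    have h2 := mul_le_mul_of_nonneg_right (hqup y) (sq_nonneg (U y))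
    exact h1.trans (by linarith)
  exact hcl

/-! ### Mass in subintervals -/

/-- A solution of `u'' = - q u` with amplitude bounded below has mass in every interval. -/
theorem HasPrimitives.mass_bound {u p w q : ℝ → ℝ} (h : HasPrimitives u p w) {H Q A a b : ℝ}
    (ha : 0 ≤ a) (hab : a < b) (hb : b ≤ H) (hQ0 : 0 ≤ Q)
    (hq : ∀ᵐ y ∂(volume.restrict (Ioo 0 H)), w y = - q y * u y) (hQ : ∀ y, q y ≤ Q)
    (hA : ∀ y ∈ Icc 0 H, A ≤ p y ^ 2 + Q * u y ^ 2) :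
    A / 2 * (∫ y in a..b, ((y - a) * (b - y)) ^ 2)
      ≤ (3 / 2 * (b - a) ^ 4 * Q + 2 * (b - a) ^ 2) * ∫ y in a..b, u y ^ 2 := by
  set s : ℝ → ℝ := fun y => (y - a) * (b - y) with hs
  have hsd : ∀ y, HasDerivAt s (a + b - 2 * y) y := by
    intro y
    have h1 := ((hasDerivAt_id y).sub_const a).mul ((hasDerivAt_id y).const_sub b)
    refine h1.congr_deriv ?_
    simp; ring
  have hf : ∀ y, HasDerivAt (fun y => s y ^ 2 * u y)
      (2 * s y * (a + b - 2 * y) * u y + s y ^ 2 * p y) y := by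
    intro y
    refine (((hsd y).pow 2).mul (h.hasDerivAt y)).congr_deriv ?_
    simp
  have hsc : Continuous s := by fun_prop
  have huc := h.continuous
  have hpc := h.continuous_deriv
  have hf'c : Continuous fun y => 2 * s y * (a + b - 2 * y) * u y + s y ^ 2 * p y := by fun_prop
  -- The equation is tested with `s² u`; the boundary terms vanish with `s`. Squaring `s` lets the
  -- cross term be absorbed by Young's inequality.
  have hibp := h.integral_deriv_mul_add hf hf'c a b
  have hsa : s a = 0 := by simp [hs]
  have hsb : s b = 0 := by simp [hs]
  simp only [hsa, hsb] at hibp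
  set M := 3 / 2 * (b - a) ^ 4 * Q + 2 * (b - a) ^ 2 with hM
  have hle : ∫ y in a..b, (A / 2 * s y ^ 2 - M * u y ^ 2) ≤ ∫ y in a..b,
      ((2 * s y * (a + b - 2 * y) * u y + s y ^ 2 * p y) * p y + s y ^ 2 * u y * w y) := by
    apply intervalIntegral.integral_mono_ae_restrict hab.le
    · exact Continuous.intervalIntegrable (by fun_prop) _ _
    · refine IntervalIntegrable.add (Continuous.intervalIntegrable (by fun_prop) _ _) ?_
      exact h.integrable.intervalIntegrable.continuousOn_mul
        (Continuous.continuousOn (by fun_prop))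
    · have hq' : ∀ᵐ y ∂(volume.restrict (Icc a b)), w y = - q y * u y := by
        rw [← restrict_Ioo_eq_restrict_Icc]
        exact ae_restrict_of_ae_restrict_of_subset (Ioo_subset_Ioo ha hb) hq
      filter_upwards [hq', ae_restrict_mem measurableSet_Icc] with y hy hyI
      rw [hy]
      have hsy0 : 0 ≤ s y := mul_nonneg (by linarith [hyI.1]) (by linarith [hyI.2])
      have hsy : s y ≤ (b - a) ^ 2 := by
        rw [pow_two]
        exact mul_le_mul (by linarith [hyI.2]) (by linarith [hyI.1]) (by linarith [hyI.2])
          (by linarith)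
      have hs2 : s y ^ 2 ≤ (b - a) ^ 4 := by
        calc s y ^ 2 ≤ ((b - a) ^ 2) ^ 2 := pow_le_pow_left₀ hsy0 hsy 2
          _ = _ := by ring
      have hs'2 : (a + b - 2 * y) ^ 2 ≤ (b - a) ^ 2 :=
        sq_le_sq' (by linarith [hyI.2]) (by linarith [hyI.1])
      have hAy := hA y ⟨ha.trans hyI.1, hyI.2.trans hb⟩
      have e1 := mul_le_mul_of_nonneg_left hAy (sq_nonneg (s y))
      have e2 := mul_le_mul_of_nonneg_left (hQ y) (mul_nonneg (sq_nonneg (s y)) (sq_nonneg (u y)))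
      have e3 := mul_le_mul_of_nonneg_right hs2 (mul_nonneg hQ0 (sq_nonneg (u y)))
      have e4 := mul_le_mul_of_nonneg_right hs'2 (sq_nonneg (u y))
      -- Half of this square bounds the cross term `2 s s' u p` below by `-s² p² / 2 - 2 s'² u²`.
      -- The remaining `s² p² / 2` is bounded below by `s² (A - Q u²) / 2`, whence the coefficient
      -- `3 / 2` of `Q`.
      have e5 := sq_nonneg (s y * p y + 2 * (a + b - 2 * y) * u y)
      simp only [hM]
      nlinarith
  rw [hibp, intervalIntegral.integral_sub, intervalIntegral.integral_const_mul,
    intervalIntegral.integral_const_mul] at hle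
  · linarith
  · exact Continuous.intervalIntegrable (by fun_prop) _ _
  · exact Continuous.intervalIntegrable (by fun_prop) _ _

theorem mass_weight_pos {a b : ℝ} (hab : a < b) : 0 < ∫ y in a..b, ((y - a) * (b - y)) ^ 2 := by
  apply intervalIntegral.intervalIntegral_pos_of_pos_on
  · exact Continuous.intervalIntegrable (by fun_prop) _ _
  · intro y hy
    have h1 : 0 < y - a := by linarith [hy.1]
    have h2 : 0 < b - y := by linarith [hy.2]
    positivity
  · exact hab

theorem integrableOn_sq_mul_inv {H cm cM : ℝ} (hcm : 0 < cm) {c U : ℝ → ℝ}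
    (hc : c ∈ Coeffs H cm cM) (hU : Continuous U) :
    IntegrableOn (fun y => U y ^ 2 * (c y)⁻¹) (Ioo 0 H) := by
  have h1 : IntegrableOn (fun y => U y ^ 2) (Ioo 0 H) :=
    ((hU.pow 2).integrableOn_Icc (a := 0) (b := H)).mono_set Ioo_subset_Icc_self
  refine Integrable.mul_bdd (c := cm⁻¹) h1 hc.1.inv.aestronglyMeasurable ?_
  filter_upwards [hc.2] with y hy
  have := hcm.trans_le hy.1
  rw [Real.norm_of_nonneg (by positivity)]
  exact inv_anti₀ hcm hy.1

/-- The constant in the lower bound for the mass in `(a, b)`. -/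
def massConst (H cm cM ε V a b : ℝ) : ℝ :=
  amplitudeConst H cm cM ε V / 2 * (∫ y in a..b, ((y - a) * (b - y)) ^ 2) /
    ((3 / 2 * (b - a) ^ 4 + 2 * (b - a) ^ 2 * H ^ 2) / cm) / cM

theorem massConst_pos {H cm cM ε V a b : ℝ} (hH : 0 < H) (hcm : 0 < cm) (hcM : cm < cM)
    (hε : 0 < ε) (hab : a < b) : 0 < massConst H cm cM ε V a b := by
  have h1 := amplitudeConst_pos (V := V) hH hcm hcM hε
  have h2 := mass_weight_pos hab
  have h3 : 0 < cM := hcm.trans hcM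
  have h4 : 0 < b - a := sub_pos.2 hab
  unfold massConst
  positivity

/-- In `HasPrimitives.mass_bound` both `A` and `Q` are proportional to `lam`. The one term without
`lam` is absorbed through `1 ≤ lam H² / cm`, and then `lam` divides out. -/
theorem IsNormalizedEigenfunction.mass_le {H cm cM ε V : ℝ} (hH : 0 < H) (hcm : 0 < cm)
    (hcM : cm < cM) (hε : 0 < ε) (hV : 0 ≤ V) {c : ℝ → ℝ} (hc : c ∈ CoeffsV H cm cM V)
    {m lam : ℝ} (hlam : (essSup c (volume.restrict (Ioo 0 H)) + ε) * m ^ 2 ≤ lam) {u : ℝ → ℝ}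
    (hu : IsNormalizedEigenfunction H c m lam u) {a b : ℝ} (ha : 0 ≤ a) (hab : a < b)
    (hb : b ≤ H) : massConst H cm cM ε V a b ≤ ∫ y in a..b, u y ^ 2 * (c y)⁻¹ := by
  obtain ⟨hl, U, p, w, q, hP, hUu, -, hw, hq, hA⟩ := hu.amplitude_bound hH hcm hcM hε hV hc hlam
  have hlpos : 0 < lam := lt_of_lt_of_le (by positivity) hl
  have hcM0 : 0 < cM := hcm.trans hcM
  have hL : 0 < b - a := sub_pos.2 hab
  have key := hP.mass_bound ha hab hb (by positivity) hw hq hA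
  have hU2 : 0 ≤ ∫ y in a..b, U y ^ 2 :=
    intervalIntegral.integral_nonneg hab.le fun y _ => sq_nonneg _
  have h1 : 3 / 2 * (b - a) ^ 4 * (lam / cm) + 2 * (b - a) ^ 2
      ≤ lam * ((3 / 2 * (b - a) ^ 4 + 2 * (b - a) ^ 2 * H ^ 2) / cm) := by
    have h2 : 1 ≤ lam * H ^ 2 / cm := by
      rw [le_div_iff₀ hcm, one_mul]
      rwa [div_le_iff₀ (by positivity)] at hl
    have h3 := mul_le_mul_of_nonneg_left h2 (by positivity : 0 ≤ 2 * (b - a) ^ 2)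
    have h4 : lam * ((3 / 2 * (b - a) ^ 4 + 2 * (b - a) ^ 2 * H ^ 2) / cm)
      = 3 / 2 * (b - a) ^ 4 * (lam / cm) + 2 * (b - a) ^ 2 * (lam * H ^ 2 / cm) := by ring
    linarith
  have h2 := key.trans (mul_le_mul_of_nonneg_right h1 hU2)
  have h3 : amplitudeConst H cm cM ε V / 2 * (∫ y in a..b, ((y - a) * (b - y)) ^ 2)
      ≤ ((3 / 2 * (b - a) ^ 4 + 2 * (b - a) ^ 2 * H ^ 2) / cm) * ∫ y in a..b, U y ^ 2 := by
    refine le_of_mul_le_mul_left ?_ hlpos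
    linarith
  have h4 : (∫ y in a..b, U y ^ 2) / cM ≤ ∫ y in a..b, u y ^ 2 * (c y)⁻¹ := by
    have h5 : ∫ y in a..b, u y ^ 2 * (c y)⁻¹ = ∫ y in a..b, U y ^ 2 * (c y)⁻¹ := by
      apply intervalIntegral.integral_congr
      intro y hy
      rw [uIcc_of_le hab.le] at hy
      simp [hUu ⟨ha.trans hy.1, hy.2.trans hb⟩]
    rw [h5, ← intervalIntegral.integral_div]
    apply intervalIntegral.integral_mono_ae_restrict hab.le
    · exact ((hP.continuous.pow 2).div_const _).intervalIntegrable _ _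
    · rw [intervalIntegrable_iff_integrableOn_Ioo_of_le hab.le]
      exact (integrableOn_sq_mul_inv hcm hc.1 hP.continuous).mono_set (Ioo_subset_Ioo ha hb)
    · rw [← restrict_Ioo_eq_restrict_Icc]
      filter_upwards [ae_restrict_of_ae_restrict_of_subset (Ioo_subset_Ioo ha hb) hc.1.2]
        with y hy
      have hcy := hcm.trans_le hy.1
      exact mul_le_mul_of_nonneg_left (inv_anti₀ hcy hy.2) (sq_nonneg _)
  refine le_trans ?_ h4
  unfold massConst
  gcongr
  rw [div_le_iff₀ (by positivity)]
  linarith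

theorem le_minAmplitudeSq {H cm cM ε V : ℝ} (hH : 0 < H) (hcm : 0 < cm)
    (hcM : cm < cM) (hε : 0 < ε) (hV : 0 ≤ V) {c : ℝ → ℝ} (hc : c ∈ CoeffsV H cm cM V)
    (μ : ℕ → ℝ) :
    ENNReal.ofReal (amplitudeConst H cm cM ε V * cm / (H ^ 2 + 1)) ≤ minAmplitudeSq H ε μ c := by
  refine le_iInf fun pr => le_iInf fun hpr => le_iInf fun u => le_iInf fun hu =>
    le_iInf fun y => le_iInf fun hy => ENNReal.ofReal_le_ofReal ?_
  obtain ⟨hl, U, p, w, q, hP, hUu, hpu, hw, hq, hA⟩ :=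
    hu.amplitude_bound hH hcm hcM hε hV hc hpr.2
  have hlpos : 0 < pr.2 := lt_of_lt_of_le (by positivity) hl
  have he := amplitudeConst_pos (V := V) hH hcm hcM hε
  rw [← hUu hy, ← hpu hy]
  have h1 := hA y hy
  have h2 : 1 ≤ pr.2 * H ^ 2 / cm := by
    rw [le_div_iff₀ hcm, one_mul]
    rwa [div_le_iff₀ (by positivity)] at hl
  have h3 : pr.2 * amplitudeConst H cm cM ε V
      ≤ (pr.2 * (H ^ 2 + 1) / cm) * (U y ^ 2 + p y ^ 2) := by
    have h4 := mul_le_mul_of_nonneg_right h2 (sq_nonneg (p y))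
    have h5 : 0 ≤ pr.2 / cm * p y ^ 2 := by positivity
    have h6 : 0 ≤ pr.2 * H ^ 2 / cm * U y ^ 2 := by positivity
    have h7 : (pr.2 * (H ^ 2 + 1) / cm) * (U y ^ 2 + p y ^ 2) = pr.2 * H ^ 2 / cm * U y ^ 2
      + pr.2 / cm * U y ^ 2 + pr.2 * H ^ 2 / cm * p y ^ 2 + pr.2 / cm * p y ^ 2 := by ring
    linarith
  rw [div_le_iff₀ (by positivity)]
  rw [show pr.2 * (H ^ 2 + 1) / cm * (U y ^ 2 + p y ^ 2)
    = pr.2 * ((H ^ 2 + 1) * (U y ^ 2 + p y ^ 2) / cm) by ring] at h3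
  have h8 := le_of_mul_le_mul_left h3 hlpos
  rw [le_div_iff₀ hcm] at h8
  linarith

/-! ### Functionals annihilating a second order operator -/

/-- Smooth functions on the line that vanish on `[b, ∞)`. -/
def SmoothVanishing (b : ℝ) (h : ℝ → ℝ) : Prop :=
  ContDiff ℝ ∞ h ∧ ∀ t, b ≤ t → h t = 0

namespace SmoothVanishing

variable {b : ℝ} {h : ℝ → ℝ}

theorem mul_left (hh : SmoothVanishing b h) {k : ℝ → ℝ} (hk : ContDiff ℝ ∞ k) :
    SmoothVanishing b fun t => k t * h t :=
  ⟨hk.mul hh.1, fun t ht => by simp [hh.2 t ht]⟩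

theorem add (hh : SmoothVanishing b h) {k : ℝ → ℝ} (hk : SmoothVanishing b k) :
    SmoothVanishing b fun t => h t + k t :=
  ⟨hh.1.add hk.1, fun t ht => by simp [hh.2 t ht, hk.2 t ht]⟩

theorem sub (hh : SmoothVanishing b h) {k : ℝ → ℝ} (hk : SmoothVanishing b k) :
    SmoothVanishing b fun t => h t - k t :=
  ⟨hh.1.sub hk.1, fun t ht => by simp [hh.2 t ht, hk.2 t ht]⟩

theorem deriv (hh : SmoothVanishing b h) : SmoothVanishing b (deriv h) := by
  have hc : ContDiff ℝ ∞ (_root_.deriv h) := (contDiff_infty_iff_deriv.1 hh.1).2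
  refine ⟨hc, ?_⟩
  have hsub : Ici b ⊆ {t | _root_.deriv h t = 0} := by
    rw [← closure_Ioi b]
    refine closure_minimal (fun t ht => ?_) (isClosed_eq hc.continuous continuous_const)
    have : h =ᶠ[nhds t] fun _ => 0 := by
      filter_upwards [Ioi_mem_nhds ht] with s hs using hh.2 s (le_of_lt hs)
    simpa using this.deriv_eq
  exact fun t ht => hsub ht

/-- The primitive that vanishes on `[b, ∞)`. -/
theorem primitive (hh : SmoothVanishing b h) :
    SmoothVanishing b (fun t => ∫ s in b..t, h s) ∧
      _root_.deriv (fun t => ∫ s in b..t, h s) = h := by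
  have hd : ∀ t, HasDerivAt (fun t => ∫ s in b..t, h s) (h t) t := fun t =>
    intervalIntegral.integral_hasDerivAt_right (hh.1.continuous.intervalIntegrable _ _)
      (hh.1.continuous.stronglyMeasurableAtFilter _ _) hh.1.continuous.continuousAt
  have he : _root_.deriv (fun t => ∫ s in b..t, h s) = h := funext fun t => (hd t).deriv
  refine ⟨⟨?_, fun t ht => ?_⟩, he⟩
  · rw [contDiff_infty_iff_deriv, he]
    exact ⟨fun t => (hd t).differentiableAt, hh.1⟩
  · rw [← intervalIntegral.integral_zero (a := b) (b := t) (E := ℝ) (μ := volume)]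
    apply intervalIntegral.integral_congr
    intro s hs
    rw [uIcc_of_le ht] at hs
    exact hh.2 s hs.1

/-- Integrating the exponential weight gains a factor `1 / τ`. A large `τ` therefore makes the lower
order terms of a differential operator small relative to the leading one. -/
theorem _root_.Layered.abs_primitive_le {a b τ B : ℝ} {h : ℝ → ℝ} (hτ : 0 < τ) (hB : 0 ≤ B)
    (hle : ∀ t ∈ Icc a b, |h t| ≤ B * Real.exp (τ * (b - t))) :
    ∀ t ∈ Icc a b, |∫ s in b..t, h s| ≤ B / τ * Real.exp (τ * (b - t)) := by
  intro t ht
  have hd : ∀ s, HasDerivAt (fun s => -(B / τ * Real.exp (τ * (b - s))))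
      (B * Real.exp (τ * (b - s))) s := by
    intro s
    have h1 := ((((hasDerivAt_id s).const_sub b).const_mul τ).exp.const_mul (B / τ)).neg
    refine h1.congr_deriv ?_
    simp; field_simp
  have hint : ∫ s in t..b, B * Real.exp (τ * (b - s))
      = -(B / τ * Real.exp (τ * (b - b))) - -(B / τ * Real.exp (τ * (b - t))) :=
    intervalIntegral.integral_eq_sub_of_hasDerivAt (fun s _ => hd s)
      (Continuous.intervalIntegrable (by fun_prop) _ _)
  rw [intervalIntegral.integral_symm, abs_neg]
  have h2 : ‖∫ s in t..b, h s‖ ≤ ∫ s in t..b, B * Real.exp (τ * (b - s)) := by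
    apply intervalIntegral.norm_integral_le_of_norm_le ht.2
    · refine Eventually.of_forall fun s hs => ?_
      exact hle s ⟨ht.1.trans hs.1.le, hs.2⟩
    · exact Continuous.intervalIntegrable (by fun_prop) _ _
  rw [hint] at h2
  have h3 : 0 ≤ B / τ * Real.exp (τ * (b - b)) := by positivity
  rw [Real.norm_eq_abs] at h2
  linarith

end SmoothVanishing

/-- The cutoff near `0` permits division by the degenerate leading coefficient `4 t` while keeping
functions smooth on the whole line; only values on `[a, b]` will matter. -/
theorem exists_smooth_inv {a : ℝ} (ha : 0 < a) :
    ∃ k : ℝ → ℝ, ContDiff ℝ ∞ k ∧ ∀ t, a ≤ t → k t = (4 * t)⁻¹ := by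
  refine ⟨fun t => Real.smoothTransition (2 * t / a - 1) * (4 * t)⁻¹, ?_, fun t ht => ?_⟩
  · rw [contDiff_iff_contDiffAt]
    intro t
    rcases lt_or_ge t (a / 2) with h | h
    · have : (fun t => Real.smoothTransition (2 * t / a - 1) * (4 * t)⁻¹) =ᶠ[nhds t]
          fun _ => 0 := by
        filter_upwards [Iio_mem_nhds h] with s hs
        rw [Real.smoothTransition.zero_of_nonpos, zero_mul]
        have : 2 * s / a ≤ 1 := by
          rw [div_le_one ha]; linarith [mem_Iio.1 hs]
        linarith
      exact contDiffAt_const.congr_of_eventuallyEq this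
    · have ht : 4 * t ≠ 0 := by
        have : 0 < t := by linarith
        positivity
      refine ContDiffAt.mul (Real.smoothTransition.contDiff.comp ?_).contDiffAt
        (ContDiffAt.inv (contDiff_const.mul contDiff_id).contDiffAt ht)
      exact ((contDiff_const.mul contDiff_id).div_const a).sub contDiff_const
  · have : 1 ≤ 2 * t / a - 1 := by
      rw [le_sub_iff_add_le, le_div_iff₀ ha]; linarith
    simp [Real.smoothTransition.one_of_one_le this]

/-- A functional on smooth functions vanishing beyond `b`, which only sees the values on `[a, b]`
with `a > 0` and annihilates the range of `4 t ∂² + α ∂ + ν`, is zero. -/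
theorem eq_zero_of_annihilates {a b α ν M : ℝ} (ha : 0 < a) {T : (ℝ → ℝ) → ℝ}
    (hT : ∀ h, SmoothVanishing b h → ∀ B, 0 ≤ B → (∀ t ∈ Icc a b, |h t| ≤ B) → |T h| ≤ M * B)
    (hsub : ∀ h k, SmoothVanishing b h → SmoothVanishing b k →
      T (fun t => h t - k t) = T h - T k)
    (hzero : ∀ g, SmoothVanishing b g →
      T (fun t => 4 * t * deriv (deriv g) t + α * deriv g t + ν * g t) = 0)
    {h : ℝ → ℝ} (hh : SmoothVanishing b h) : T h = 0 := by
  obtain ⟨κ, hκ, hκa⟩ := exists_smooth_inv ha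
  -- Chosen so that, in the weighted norm, the lower order terms have relative size at most `1 / 2`.
  set τ := 1 + (|α| + |ν|) / (2 * a) with hτ
  have hτ1 : 1 ≤ τ := by rw [hτ]; linarith [show 0 ≤ (|α| + |ν|) / (2 * a) by positivity]
  have hτ0 : 0 < τ := by linarith
  have hατ : (|α| + |ν|) / (4 * a * τ) ≤ 1 / 2 := by
    rw [div_le_iff₀ (by positivity), hτ]
    field_simp
    linarith
  -- One Picard step: let `g0` be the double primitive of `h / (4 t)`. Subtracting its image under
  -- the operator cancels `h` on `[a, b]` and leaves only lower order terms, without changing `T`.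
  -- The iteration drives `T h` to zero, so the differential equation need not be solved exactly.
  have step : ∀ h, SmoothVanishing b h → ∀ B, 0 ≤ B →
      (∀ t ∈ Icc a b, |h t| ≤ B * Real.exp (τ * (b - t))) →
      ∃ h', SmoothVanishing b h' ∧ T h' = T h ∧
        ∀ t ∈ Icc a b, |h' t| ≤ B / 2 * Real.exp (τ * (b - t)) := by
    intro h hh B hB hle
    have h2 := hh.mul_left hκ
    obtain ⟨h1, hd1⟩ := h2.primitive
    obtain ⟨h0, hd0⟩ := h1.primitive
    set g1 : ℝ → ℝ := fun t => ∫ s in b..t, κ s * h s with hg1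
    set g0 : ℝ → ℝ := fun t => ∫ s in b..t, g1 s with hg0
    have hL : SmoothVanishing b
        (fun t => 4 * t * deriv (deriv g0) t + α * deriv g0 t + ν * g0 t) :=
      ((h0.deriv.deriv.mul_left (contDiff_const.mul contDiff_id)).add
        (h0.deriv.mul_left contDiff_const)).add (h0.mul_left contDiff_const)
    refine ⟨_, hh.sub hL, ?_, ?_⟩
    · rw [hsub _ _ hh hL, hzero _ h0, sub_zero]
    · have b2 : ∀ t ∈ Icc a b, |κ t * h t| ≤ B / (4 * a) * Real.exp (τ * (b - t)) := by
        intro t ht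
        have ht0 := ha.trans_le ht.1
        rw [hκa t ht.1, abs_mul, abs_of_pos (by positivity), div_eq_mul_inv, mul_comm B, mul_assoc]
        have := hle t ht
        gcongr
        exact ht.1
      have b1 := abs_primitive_le hτ0 (by positivity) b2
      have b0 := abs_primitive_le hτ0 (by positivity) b1
      intro t ht
      have ht0 := ha.trans_le ht.1
      have e1 := b1 t ht
      have e0 := b0 t ht
      rw [hd0, hd1]
      dsimp only
      rw [hκa t ht.1]
      have : h t - (4 * t * ((4 * t)⁻¹ * h t) + α * g1 t + ν * g0 t)
          = -(α * g1 t + ν * g0 t) := by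
        field_simp; ring
      rw [this, abs_neg]
      set X := Real.exp (τ * (b - t)) with hX
      have hX0 : 0 < X := Real.exp_pos _
      have e0' : |g0 t| ≤ B / (4 * a) / τ * X := by
        refine e0.trans ?_
        have : B / (4 * a) / τ / τ ≤ B / (4 * a) / τ := div_le_self (by positivity) hτ1
        gcongr
      calc |α * g1 t + ν * g0 t| ≤ |α| * |g1 t| + |ν| * |g0 t| := by
            rw [← abs_mul, ← abs_mul]; exact abs_add_le _ _
        _ ≤ |α| * (B / (4 * a) / τ * X) + |ν| * (B / (4 * a) / τ * X) := by gcongr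
        _ = (|α| + |ν|) / (4 * a * τ) * (B * X) := by field_simp
        _ ≤ 1 / 2 * (B * X) := by gcongr
        _ = B / 2 * X := by ring
  have iter : ∀ n : ℕ, ∀ h, SmoothVanishing b h → ∀ B, 0 ≤ B →
      (∀ t ∈ Icc a b, |h t| ≤ B * Real.exp (τ * (b - t))) →
      |T h| ≤ M * Real.exp (τ * (b - a)) * B * (1 / 2) ^ n := by
    intro n
    induction n with
    | zero =>
      intro h hh B hB hle
      have := hT h hh (B * Real.exp (τ * (b - a))) (by positivity) fun t ht =>
        (hle t ht).trans (by gcongr; exact ht.1)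
      linarith
    | succ n ih =>
      intro h hh B hB hle
      obtain ⟨h', hh', hTh', hle'⟩ := step h hh B hB hle
      have := ih h' hh' (B / 2) (by positivity) hle'
      rw [hTh'] at this
      calc |T h| ≤ _ := this
        _ = _ := by rw [pow_succ]; ring
  obtain ⟨B, hB⟩ := isCompact_Icc (a := a) (b := b) |>.exists_bound_of_continuousOn
    hh.1.continuous.continuousOn
  have hlim : Tendsto (fun n : ℕ => M * Real.exp (τ * (b - a)) * |B| * (1 / 2 : ℝ) ^ n) atTop
      (nhds (M * Real.exp (τ * (b - a)) * |B| * 0)) :=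
    (tendsto_pow_atTop_nhds_zero_of_lt_one (by norm_num) (by norm_num)).const_mul _
  have hfin := ge_of_tendsto' hlim fun n => iter n h hh |B| (abs_nonneg B) fun t ht => by
    have h1 : 1 ≤ Real.exp (τ * (b - t)) :=
      Real.one_le_exp (mul_nonneg hτ0.le (sub_nonneg.2 ht.2))
    have h2 := mul_le_mul_of_nonneg_left h1 (abs_nonneg B)
    have h3 := (hB t ht).trans (le_abs_self B)
    rw [Real.norm_eq_abs] at h3
    linarith
  rw [mul_zero] at hfin
  exact abs_nonpos_iff.1 hfin

section

/-! ### Test functions adapted to spheres -/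

theorem pderiv_add {d : ℕ} (i : Fin d) {f g : EuclideanSpace ℝ (Fin d) → ℝ}
    (hf : Differentiable ℝ f) (hg : Differentiable ℝ g) :
    pderiv i (fun x => f x + g x) = fun x => pderiv i f x + pderiv i g x := by
  funext x
  simp [pderiv, fderiv_fun_add (hf x) (hg x)]

theorem pderiv_const_mul {d : ℕ} (i : Fin d) {f : EuclideanSpace ℝ (Fin d) → ℝ} (a : ℝ)
    (hf : Differentiable ℝ f) :
    pderiv i (fun x => a * f x) = fun x => a * pderiv i f x := by
  funext x
  simp [pderiv, fderiv_const_mul (hf x)]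

theorem pderiv_coord_mul {d : ℕ} (i : Fin d) {f : EuclideanSpace ℝ (Fin d) → ℝ} (a : ℝ)
    (hf : Differentiable ℝ f) :
    pderiv i (fun x => (x i - a) * f x) = fun x => f x + (x i - a) * pderiv i f x := by
  funext x
  have h1 : HasFDerivAt (fun x : EuclideanSpace ℝ (Fin d) => x i - a)
      (EuclideanSpace.proj i : EuclideanSpace ℝ (Fin d) →L[ℝ] ℝ) x :=
    (EuclideanSpace.proj (𝕜 := ℝ) i).hasFDerivAt.sub_const a
  simp only [pderiv]
  rw [(h1.fun_mul (hf x).hasFDerivAt).fderiv]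
  simp
  ring

/-- The product of a power of a linear form and a radial function, centered at `x₀`. -/
def radialTest {d : ℕ} (x₀ ξ : EuclideanSpace ℝ (Fin d)) (k : ℕ) (g : ℝ → ℝ) :
    EuclideanSpace ℝ (Fin d) → ℝ :=
  fun x => inner ℝ ξ (x - x₀) ^ k * g (‖x - x₀‖ ^ 2)

variable {d : ℕ} (x₀ ξ : EuclideanSpace ℝ (Fin d)) (k : ℕ)

theorem contDiff_radialTest {g : ℝ → ℝ} (hg : ContDiff ℝ ∞ g) :
    ContDiff ℝ ∞ (radialTest x₀ ξ k g) := by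
  have h1 : ContDiff ℝ ∞ fun x : EuclideanSpace ℝ (Fin d) => x - x₀ :=
    contDiff_id.sub contDiff_const
  exact ((contDiff_const.inner ℝ h1).pow k).mul (hg.comp (h1.norm_sq ℝ))

theorem pderiv_radialTest (i : Fin d) {g : ℝ → ℝ} (hg : Differentiable ℝ g) :
    pderiv i (radialTest x₀ ξ k g) = fun x => ξ i * k * radialTest x₀ ξ (k - 1) g x
      + 2 * ((x i - x₀ i) * radialTest x₀ ξ k (deriv g) x) := by
  funext x
  have h0 : HasFDerivAt (fun x : EuclideanSpace ℝ (Fin d) => x - x₀)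
      (ContinuousLinearMap.id ℝ _) x := (hasFDerivAt_id x).sub_const x₀
  have h1 : HasFDerivAt (fun x : EuclideanSpace ℝ (Fin d) => inner ℝ ξ (x - x₀))
      (innerSL ℝ ξ) x := by
    have := ((innerSL ℝ ξ).hasFDerivAt (x := x - x₀)).comp x h0
    rwa [ContinuousLinearMap.comp_id] at this
  have h2 := h0.norm_sq
  have h3 := (hg (‖x - x₀‖ ^ 2)).hasDerivAt.comp_hasFDerivAt x h2
  have h4 := (h1.pow k).mul h3
  unfold pderiv
  have h5 : radialTest x₀ ξ k g = (fun x => inner ℝ ξ (x - x₀) ^ k) * (g ∘ fun x => ‖x - x₀‖ ^ 2) :=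
    rfl
  rw [h5, h4.fderiv]
  simp [radialTest, EuclideanSpace.inner_single_right]
  ring

/-- The Laplacian preserves this class up to a term with the power lowered by two, which suits an
induction on `k`; on the radial factor it acts as an ordinary differential operator. The truncated
subtractions are harmless because `k (k - 1)` vanishes for `k < 2`. -/
theorem sum_pderiv_pderiv_radialTest {g : ℝ → ℝ} (hg : ContDiff ℝ ∞ g)
    (x : EuclideanSpace ℝ (Fin d)) :
    ∑ i, pderiv i (pderiv i (radialTest x₀ ξ k g)) x
      = k * (k - 1 : ℕ) * ‖ξ‖ ^ 2 * radialTest x₀ ξ (k - 2) g x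
        + radialTest x₀ ξ k
          (fun t => 4 * t * deriv (deriv g) t + (4 * k + 2 * d) * deriv g t) x := by
  have hg1 : ContDiff ℝ ∞ (deriv g) := (contDiff_infty_iff_deriv.1 hg).2
  have hgd : Differentiable ℝ g := (contDiff_infty_iff_deriv.1 hg).1
  have hgd1 : Differentiable ℝ (deriv g) := (contDiff_infty_iff_deriv.1 hg1).1
  have hR : ∀ k g, ContDiff ℝ ∞ g → Differentiable ℝ (radialTest x₀ ξ k g) := fun k g hg =>
    (contDiff_radialTest x₀ ξ k hg).differentiable (by simp)
  have hc : ∀ i : Fin d, Differentiable ℝ fun x : EuclideanSpace ℝ (Fin d) => x i - x₀ i :=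
    fun i => (EuclideanSpace.proj (𝕜 := ℝ) i).differentiable.sub_const _
  have key : ∀ i, pderiv i (pderiv i (radialTest x₀ ξ k g)) x
      = k * (k - 1 : ℕ) * radialTest x₀ ξ (k - 2) g x * ξ i ^ 2
        + 4 * k * radialTest x₀ ξ (k - 1) (deriv g) x * (ξ i * (x i - x₀ i))
        + 2 * radialTest x₀ ξ k (deriv g) x
        + 4 * radialTest x₀ ξ k (deriv (deriv g)) x * (x i - x₀ i) ^ 2 := by
    intro i
    rw [pderiv_radialTest x₀ ξ k i hgd, pderiv_add i ((hR _ _ hg).const_mul _)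
      (((hc i).fun_mul (hR _ _ hg1)).const_mul _), pderiv_const_mul i _ (hR _ _ hg),
      pderiv_const_mul i _ ((hc i).fun_mul (hR _ _ hg1)), pderiv_coord_mul i _ (hR _ _ hg1),
      pderiv_radialTest x₀ ξ (k - 1) i hgd, pderiv_radialTest x₀ ξ k i hgd1]
    simp only [Nat.sub_sub]
    ring
  have hn : ∑ i, ξ i ^ 2 = ‖ξ‖ ^ 2 := (EuclideanSpace.real_norm_sq_eq ξ).symm
  have hn' : ∑ i, (x i - x₀ i) ^ 2 = ‖x - x₀‖ ^ 2 :=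
    (EuclideanSpace.real_norm_sq_eq (x - x₀)).symm
  have hin : ∑ i, ξ i * (x i - x₀ i) = inner ℝ ξ (x - x₀) := by
    rw [PiLp.inner_apply]
    exact Finset.sum_congr rfl fun i _ => by simp [mul_comm]
  simp only [key, Finset.sum_add_distrib, ← Finset.mul_sum, hn, hn', hin]
  have hk : (k : ℝ) * radialTest x₀ ξ (k - 1) (deriv g) x * inner ℝ ξ (x - x₀)
      = k * radialTest x₀ ξ k (deriv g) x := by
    rcases k with _ | k
    · simp
    · simp only [radialTest, Nat.add_sub_cancel, pow_succ]; ring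
  have h4 : 4 * (k : ℝ) * radialTest x₀ ξ (k - 1) (deriv g) x * inner ℝ ξ (x - x₀)
      = 4 * (k * radialTest x₀ ξ k (deriv g) x) := by rw [← hk]; ring
  rw [h4]
  simp only [radialTest, Finset.sum_const, Finset.card_univ, Fintype.card_fin, nsmul_eq_mul]
  ring

theorem isTestFunction_radialTest {D : Set (EuclideanSpace ℝ (Fin d))} {R : ℝ} (hR : 0 ≤ R)
    (hD : Metric.closedBall x₀ R ⊆ D) {g : ℝ → ℝ} (hg : SmoothVanishing (R ^ 2) g) :
    IsTestFunction D (radialTest x₀ ξ k g) := by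
  have hs : tsupport (radialTest x₀ ξ k g) ⊆ Metric.closedBall x₀ R := by
    refine closure_minimal (fun x hx => ?_) Metric.isClosed_closedBall
    by_contra hcon
    rw [Metric.mem_closedBall, dist_eq_norm, not_le] at hcon
    apply hx
    simp [radialTest, hg.2 _ (pow_le_pow_left₀ hR hcon.le 2)]
  exact ⟨contDiff_radialTest x₀ ξ k hg.1,
    (isCompact_closedBall x₀ R).of_isClosed_subset (isClosed_tsupport _) hs, hs.trans hD⟩

theorem IsTestFunction.pderiv {D : Set (EuclideanSpace ℝ (Fin d))}
    {ψ : EuclideanSpace ℝ (Fin d) → ℝ} (hψ : IsTestFunction D ψ) (i : Fin d) :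
    IsTestFunction D (pderiv i ψ) :=
  ⟨(hψ.1.fderiv_right (m := ∞) le_rfl).clm_apply contDiff_const, hψ.2.1.fderiv_apply ℝ _,
    (tsupport_fderiv_apply_subset ℝ _).trans hψ.2.2⟩

theorem IsTestFunction.integrable_mul {D : Set (EuclideanSpace ℝ (Fin d))}
    {ψ f : EuclideanSpace ℝ (Fin d) → ℝ} (hψ : IsTestFunction D ψ)
    (hf : IntegrableOn f D) : IntegrableOn (fun x => f x * ψ x) D := by
  obtain ⟨C, hC⟩ := hψ.2.1.exists_bound_of_continuous hψ.1.continuous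
  exact Integrable.mul_bdd (c := C) hf hψ.1.continuous.aestronglyMeasurable
    (Eventually.of_forall hC)

/-- Dirichlet eigenfunctions satisfy the Helmholtz equation in the sense of distributions. -/
theorem SolvesDirichlet.integral_mul_sum_pderiv {D : Set (EuclideanSpace ℝ (Fin d))}
    (hDb : Bornology.IsBounded D) {ν : ℝ} {f ψ : EuclideanSpace ℝ (Fin d) → ℝ}
    (hf : SolvesDirichlet D ν f) (hψ : IsTestFunction D ψ) :
    ∫ x in D, f x * ∑ i, Layered.pderiv i (Layered.pderiv i ψ) x
      = - ν * ∫ x in D, f x * ψ x := by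
  obtain ⟨g, h, ⟨hf2, hg, hh⟩, -, heq⟩ := hf
  have : IsFiniteMeasure (volume.restrict D) :=
    ⟨by rw [Measure.restrict_apply_univ]; exact hDb.measure_lt_top⟩
  have hfi : IntegrableOn f D := hf2.integrable one_le_two
  have h1 : ∀ i, ∫ x in D, f x * Layered.pderiv i (Layered.pderiv i ψ) x
      = ∫ x in D, h i i x * ψ x := by
    intro i
    rw [(hg i).2 _ (hψ.pderiv i), (hh i i).2 _ hψ, neg_neg]
  simp only [Finset.mul_sum]
  rw [integral_finsetSum _ fun i _ => ((hψ.pderiv i).pderiv i).integrable_mul hfi]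
  simp only [h1]
  rw [← integral_finsetSum _ fun i _ =>
    hψ.integrable_mul ((hh i i).1.integrable one_le_two), ← integral_const_mul]
  apply integral_congr_ae
  filter_upwards [heq] with x hx
  rw [← Finset.sum_mul]
  linear_combination -(ψ x) * hx

end

/-! ### Unique continuation for the Helmholtz equation -/

section

variable {d : ℕ}

/-- A weak solution of the Helmholtz equation that vanishes near `x₀` is orthogonal to all products
of powers of linear forms and radial functions supported in a ball inside the domain. -/
theorem integral_mul_radialTest_eq_zero {D : Set (EuclideanSpace ℝ (Fin d))} {ν r R : ℝ}
    {f : EuclideanSpace ℝ (Fin d) → ℝ} (hf : IntegrableOn f D)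
    (hw : ∀ ψ, IsTestFunction D ψ →
      ∫ x in D, f x * ∑ i, pderiv i (pderiv i ψ) x = - ν * ∫ x in D, f x * ψ x)
    {x₀ : EuclideanSpace ℝ (Fin d)} (hr : 0 < r) (hR : 0 ≤ R) (hD : Metric.closedBall x₀ R ⊆ D)
    (h0 : ∀ᵐ x ∂(volume.restrict D), ‖x - x₀‖ < r → f x = 0)
    (ξ : EuclideanSpace ℝ (Fin d)) (k : ℕ) :
    ∀ h, SmoothVanishing (R ^ 2) h → ∫ x in D, f x * radialTest x₀ ξ k h x = 0 := by
  induction k using Nat.strong_induction_on with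
  | _ k ih =>
  have hint : ∀ (j : ℕ) (g : ℝ → ℝ), SmoothVanishing (R ^ 2) g →
      IntegrableOn (fun x => f x * radialTest x₀ ξ j g x) D := fun j g hg =>
    (isTestFunction_radialTest x₀ ξ j hR hD hg).integrable_mul hf
  intro h hh
  -- The radial variable is `t = ‖x - x₀‖²`. As `f` vanishes for `t < r²` and the radial factor for
  -- `t ≥ R²`, the functional sees only an interval away from the degeneracy at `t = 0`.
  refine eq_zero_of_annihilates (a := r ^ 2) (b := R ^ 2) (α := 4 * k + 2 * d) (ν := ν)
    (M := (‖ξ‖ * R) ^ k * ∫ x in D, ‖f x‖)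
    (T := fun h => ∫ x in D, f x * radialTest x₀ ξ k h x) (by positivity) ?_ ?_ ?_ hh
  · intro h hh B hB hle
    have h1 : ‖∫ x in D, f x * radialTest x₀ ξ k h x‖
        ≤ ∫ x in D, ((‖ξ‖ * R) ^ k * B) * ‖f x‖ := by
      refine norm_integral_le_of_norm_le (hf.norm.const_mul _) ?_
      filter_upwards [h0] with x hx
      rcases lt_or_ge ‖x - x₀‖ r with hlt | hge
      · rw [hx hlt]; simp
      rcases lt_or_ge R ‖x - x₀‖ with hlt | hge'
      · have : radialTest x₀ ξ k h x = 0 := by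
          simp [radialTest, hh.2 _ (pow_le_pow_left₀ hR hlt.le 2)]
        rw [this, mul_zero, norm_zero]
        positivity
      · rw [norm_mul, mul_comm]
        refine mul_le_mul_of_nonneg_right ?_ (norm_nonneg _)
        rw [radialTest, norm_mul, norm_pow]
        gcongr
        · exact (norm_inner_le_norm _ _).trans (by gcongr)
        · exact hle _ ⟨pow_le_pow_left₀ hr.le hge 2, pow_le_pow_left₀ (norm_nonneg _) hge' 2⟩
    rw [integral_const_mul] at h1
    calc _ ≤ _ := h1
      _ = _ := by ring
  · intro h g hh hg
    rw [← integral_sub (hint k h hh) (hint k g hg)]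
    congr 1; funext x
    simp only [radialTest]; ring
  · intro g hg
    have hL : SmoothVanishing (R ^ 2)
        (fun t => 4 * t * deriv (deriv g) t + (4 * k + 2 * d) * deriv g t) :=
      (hg.deriv.deriv.mul_left (contDiff_const.mul contDiff_id)).add
        (hg.deriv.mul_left contDiff_const)
    have key := hw _ (isTestFunction_radialTest x₀ ξ k hR hD hg)
    have hlow : (k : ℝ) * (k - 1 : ℕ) * ‖ξ‖ ^ 2 * ∫ x in D, f x * radialTest x₀ ξ (k - 2) g x
        = 0 := by
      rcases lt_or_ge k 2 with hk | hk
      · interval_cases k <;> simp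
      · rw [ih (k - 2) (by omega) g hg, mul_zero]
    have hsplit : ∫ x in D, f x * ∑ i, pderiv i (pderiv i (radialTest x₀ ξ k g)) x
        = (k : ℝ) * (k - 1 : ℕ) * ‖ξ‖ ^ 2 * (∫ x in D, f x * radialTest x₀ ξ (k - 2) g x)
          + ∫ x in D, f x * radialTest x₀ ξ k
            (fun t => 4 * t * deriv (deriv g) t + (4 * k + 2 * d) * deriv g t) x := by
      rw [← integral_const_mul, ← integral_add ((hint (k - 2) g hg).const_mul _) (hint k _ hL)]
      congr 1; funext x
      rw [sum_pderiv_pderiv_radialTest x₀ ξ k hg.1]; ring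
    rw [hsplit, hlow, zero_add] at key
    have hfin : ∫ x in D, f x * radialTest x₀ ξ k
          (fun t => 4 * t * deriv (deriv g) t + (4 * k + 2 * d) * deriv g t + ν * g t) x
        = (∫ x in D, f x * radialTest x₀ ξ k
            (fun t => 4 * t * deriv (deriv g) t + (4 * k + 2 * d) * deriv g t) x)
          + ν * ∫ x in D, f x * radialTest x₀ ξ k g x := by
      rw [← integral_const_mul, ← integral_add (hint k _ hL) ((hint k g hg).const_mul _)]
      congr 1; funext x
      simp only [radialTest]; ring
    rw [hfin, key]; ring

/-- A compactly supported integrable function whose moments vanish is zero. -/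
theorem ae_eq_zero_of_moments {F : EuclideanSpace ℝ (Fin d) → ℝ} (hF : Integrable F) {R : ℝ}
    {x₀ : EuclideanSpace ℝ (Fin d)} (hsupp : ∀ x, R < ‖x - x₀‖ → F x = 0)
    (hmom : ∀ (ξ : EuclideanSpace ℝ (Fin d)) (k : ℕ), ∫ x, F x * inner ℝ ξ (x - x₀) ^ k = 0) :
    F =ᵐ[volume] 0 := by
  -- The exponential is expanded in powers of the centered linear form. On the support of `F` that
  -- form is at most `‖ξ‖ R`, which gives a summable dominating series; recentering costs only a
  -- phase factor.
  have hexp : ∀ ξ : EuclideanSpace ℝ (Fin d),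
      ∫ x, (F x : ℂ) * Complex.exp (inner ℝ x ξ * Complex.I) = 0 := by
    intro ξ
    set z : EuclideanSpace ℝ (Fin d) → ℂ := fun x => (inner ℝ ξ (x - x₀) : ℝ) * Complex.I with hz
    have hzc : Continuous z := by fun_prop
    have hsum : HasSum (fun n : ℕ => ∫ x, (F x : ℂ) * (z x ^ n / (n.factorial : ℂ)))
        (∫ x, (F x : ℂ) * Complex.exp (z x)) := by
      refine hasSum_integral_of_dominated_convergence
        (bound := fun n x => ‖F x‖ * ((‖ξ‖ * R) ^ n / n.factorial)) ?_ ?_ ?_ ?_ ?_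
      · intro n
        exact (Complex.continuous_ofReal.comp_aestronglyMeasurable hF.1).mul
          (Continuous.aestronglyMeasurable (by fun_prop))
      · refine fun n => Eventually.of_forall fun x => ?_
        rcases lt_or_ge R ‖x - x₀‖ with hlt | hge
        · simp [hsupp x hlt]
        · rw [norm_mul, norm_div, norm_pow, Complex.norm_real, Complex.norm_natCast]
          have : ‖z x‖ ≤ ‖ξ‖ * R := by
            rw [hz, norm_mul, Complex.norm_I, mul_one, Complex.norm_real]
            exact (norm_inner_le_norm _ _).trans (by gcongr)
          gcongr
      · exact Eventually.of_forall fun x => (Real.summable_pow_div_factorial _).mul_left _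
      · simp only [tsum_mul_left]
        exact hF.norm.mul_const _
      · refine Eventually.of_forall fun x => ?_
        have := NormedSpace.expSeries_div_hasSum_exp (z x)
        rw [← Complex.exp_eq_exp_ℂ] at this
        exact this.mul_left _
    have hterm : ∀ n : ℕ, ∫ x, (F x : ℂ) * (z x ^ n / (n.factorial : ℂ)) = 0 := by
      intro n
      have h1 : ∀ x, (F x : ℂ) * (z x ^ n / (n.factorial : ℂ))
          = ((F x * inner ℝ ξ (x - x₀) ^ n : ℝ) : ℂ) * (Complex.I ^ n / (n.factorial : ℂ)) := by
        intro x
        rw [hz]; push_cast; ring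
      simp only [h1]
      rw [integral_mul_const, integral_complex_ofReal, hmom]
      simp
    simp only [hterm] at hsum
    have h0 := hsum.unique hasSum_zero
    have h2 : ∀ x, (F x : ℂ) * Complex.exp (inner ℝ x ξ * Complex.I)
        = ((F x : ℂ) * Complex.exp (z x)) * Complex.exp (inner ℝ ξ x₀ * Complex.I) := by
      intro x
      rw [mul_assoc, ← Complex.exp_add, hz]
      congr 2
      simp only [inner_sub_right, real_inner_comm x ξ]
      push_cast; ring
    simp only [h2]
    rw [integral_mul_const, h0, zero_mul]
  have hp : AEMeasurable (fun x => ENNReal.ofReal (F x)) := hF.1.aemeasurable.ennreal_ofReal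
  have hn : AEMeasurable (fun x => ENNReal.ofReal (-F x)) := hF.1.aemeasurable.neg.ennreal_ofReal
  have hpf : IsFiniteMeasure (volume.withDensity fun x => ENNReal.ofReal (F x)) :=
    isFiniteMeasure_withDensity_ofReal hF.2
  have hnf : IsFiniteMeasure (volume.withDensity fun x => ENNReal.ofReal (-F x)) :=
    isFiniteMeasure_withDensity_ofReal hF.neg.2
  -- The positive and negative parts of `F` define finite measures, and `hexp` says that their
  -- characteristic functions agree.
  have hchar : volume.withDensity (fun x => ENNReal.ofReal (F x))
      = volume.withDensity fun x => ENNReal.ofReal (-F x) := by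
    apply Measure.ext_of_charFun
    funext ξ
    rw [charFun_apply, charFun_apply,
      integral_withDensity_eq_integral_toReal_smul₀ hp (by simp),
      integral_withDensity_eq_integral_toReal_smul₀ hn (by simp), ← sub_eq_zero,
      ← integral_sub]
    · rw [← hexp ξ]
      congr 1; funext x
      rw [← sub_smul, ENNReal.toReal_ofReal', ENNReal.toReal_ofReal', Complex.real_smul]
      congr 2
      rcases le_total 0 (F x) with h | h
      · simp [h]
      · simp [h]
    all_goals
      simp only [Complex.real_smul, ENNReal.toReal_ofReal']
      refine Integrable.mul_bdd (c := 1) (Integrable.ofReal ?_)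
        (Continuous.aestronglyMeasurable (by fun_prop))
        (Eventually.of_forall fun x => (Complex.norm_exp_ofReal_mul_I _).le)
    · exact hF.pos_part
    · exact hF.neg_part
  have hae := (withDensity_eq_iff_of_sigmaFinite hp hn).1 hchar
  filter_upwards [hae] with x hx
  rcases le_total 0 (F x) with h | h
  · rw [ENNReal.ofReal_of_nonpos (neg_nonpos.2 h), ENNReal.ofReal_eq_zero] at hx
    exact le_antisymm hx h
  · rw [ENNReal.ofReal_of_nonpos h, eq_comm, ENNReal.ofReal_eq_zero] at hx
    exact le_antisymm h (by simpa using hx)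

/-- Propagation of zeros from a small ball to a concentric larger ball inside the domain. -/
theorem ae_eq_zero_ball {D : Set (EuclideanSpace ℝ (Fin d))} (hDm : MeasurableSet D) {ν r R : ℝ}
    {f : EuclideanSpace ℝ (Fin d) → ℝ} (hf : IntegrableOn f D)
    (hw : ∀ ψ, IsTestFunction D ψ →
      ∫ x in D, f x * ∑ i, pderiv i (pderiv i ψ) x = - ν * ∫ x in D, f x * ψ x)
    {x₀ : EuclideanSpace ℝ (Fin d)} (hr : 0 < r) (hR : 0 ≤ R) (hD : Metric.closedBall x₀ R ⊆ D)
    (h0 : ∀ᵐ x ∂(volume.restrict D), ‖x - x₀‖ < r → f x = 0) :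
    ∀ᵐ x ∂(volume.restrict D), ‖x - x₀‖ < R → f x = 0 := by
  -- A smooth radial cutoff that is strictly positive in the open ball of radius `R`, so that `f χ =
  -- 0` implies `f = 0` there.
  set χ : ℝ → ℝ := fun t => expNegInvGlue (R ^ 2 - t) with hχ
  have hχs : SmoothVanishing (R ^ 2) χ :=
    ⟨expNegInvGlue.contDiff.comp (contDiff_const.sub contDiff_id),
      fun t ht => expNegInvGlue.zero_of_nonpos (by linarith)⟩
  have hmom := fun ξ k => integral_mul_radialTest_eq_zero hf hw hr hR hD h0 ξ k χ hχs
  have key := ae_eq_zero_of_moments (R := R) (x₀ := x₀)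
    (F := D.indicator fun x => f x * χ (‖x - x₀‖ ^ 2)) ?_ ?_ ?_
  · rw [ae_restrict_iff' hDm]
    filter_upwards [key] with x hx hxD hxR
    rw [indicator_of_mem hxD] at hx
    have : 0 < χ (‖x - x₀‖ ^ 2) := by
      apply expNegInvGlue.pos_of_pos
      have := pow_lt_pow_left₀ hxR (norm_nonneg _) two_ne_zero
      linarith
    exact (mul_eq_zero.1 hx).resolve_right this.ne'
  · rw [integrable_indicator_iff hDm]
    have := (isTestFunction_radialTest x₀ 0 0 hR hD hχs).integrable_mul hf
    simpa [radialTest] using this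
  · intro x hx
    simp [indicator, hχs.2 _ (pow_le_pow_left₀ hR hx.le 2)]
  · intro ξ k
    have h1 : ∀ x, D.indicator (fun x => f x * χ (‖x - x₀‖ ^ 2)) x * inner ℝ ξ (x - x₀) ^ k
        = D.indicator (fun x => f x * radialTest x₀ ξ k χ x) x := by
      intro x
      by_cases hx : x ∈ D
      · simp only [indicator_of_mem hx, radialTest]; ring
      · simp [indicator_of_notMem hx]
    simp only [h1]
    rw [integral_indicator hDm, hmom]

/-- Unique continuation for weak solutions of the Helmholtz equation. -/
theorem ae_eq_zero_of_ae_eq_zero_on {D : Set (EuclideanSpace ℝ (Fin d))} (hDo : IsOpen D)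
    (hDc : IsConnected D) {ν : ℝ} {f : EuclideanSpace ℝ (Fin d) → ℝ} (hf : IntegrableOn f D)
    (hw : ∀ ψ, IsTestFunction D ψ →
      ∫ x in D, f x * ∑ i, pderiv i (pderiv i ψ) x = - ν * ∫ x in D, f x * ψ x)
    {W : Set (EuclideanSpace ℝ (Fin d))} (hWo : IsOpen W) (hWD : W ⊆ D) (hWne : W.Nonempty)
    (h0 : f =ᵐ[volume.restrict W] 0) : f =ᵐ[volume.restrict D] 0 := by
  set Z : Set (EuclideanSpace ℝ (Fin d)) :=
    {x | ∃ r > 0, ∀ᵐ y ∂(volume.restrict D), ‖y - x‖ < r → f y = 0} with hZ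
  have hZo : IsOpen Z := by
    rw [Metric.isOpen_iff]
    rintro x ⟨r, hr, hx⟩
    refine ⟨r / 2, by positivity, fun z hz => ⟨r / 2, by positivity, ?_⟩⟩
    filter_upwards [hx] with y hy hyz
    refine hy ?_
    rw [Metric.mem_ball, dist_eq_norm] at hz
    calc ‖y - x‖ = ‖(y - z) + (z - x)‖ := by congr 1; abel
      _ ≤ ‖y - z‖ + ‖z - x‖ := norm_add_le _ _
      _ < r := by linarith
  have hDZ : D ⊆ Z := by
    refine hDc.isPreconnected.subset_of_closure_inter_subset hZo ?_ ?_
    · obtain ⟨x, hx⟩ := hWne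
      obtain ⟨r, hr, hrW⟩ := Metric.isOpen_iff.1 hWo x hx
      refine ⟨x, hWD hx, r, hr, ?_⟩
      rw [EventuallyEq, ae_restrict_iff' hWo.measurableSet] at h0
      filter_upwards [ae_restrict_of_ae h0] with y hy hyx
      exact hy (hrW (by rwa [Metric.mem_ball, dist_eq_norm]))
    · rintro x ⟨hxZ, hxD⟩
      obtain ⟨R, hR, hRD⟩ := Metric.isOpen_iff.1 hDo x hxD
      -- The ball of radius `R / 2` about `z` still lies in `D` and contains the ball of radius `R /
      -- 4` about `x`.
      obtain ⟨z, hzZ, hz⟩ := Metric.mem_closure_iff.1 hxZ (R / 4) (by positivity)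
      obtain ⟨r, hr, hzr⟩ := hzZ
      have hsub : Metric.closedBall z (R / 2) ⊆ D := by
        refine Subset.trans (fun y hy => ?_) hRD
        rw [Metric.mem_closedBall] at hy
        rw [Metric.mem_ball]
        have := dist_triangle y z x
        rw [dist_comm z x] at this
        linarith
      have hball := ae_eq_zero_ball hDo.measurableSet hf hw hr (by positivity) hsub hzr
      refine ⟨R / 4, by positivity, ?_⟩
      filter_upwards [hball] with y hy hyx
      refine hy ?_
      rw [dist_eq_norm] at hz
      calc ‖y - z‖ = ‖(y - x) + (x - z)‖ := by congr 1; abel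
        _ ≤ ‖y - x‖ + ‖x - z‖ := norm_add_le _ _
        _ < R / 2 := by linarith
  rw [EventuallyEq, ae_restrict_iff' hDo.measurableSet]
  have hnull : volume ({x | ¬ (x ∈ D → f x = 0)}) = 0 := by
    apply measure_null_of_locally_null
    rintro x hx
    simp only [mem_ofPred_eq, Classical.not_imp] at hx
    obtain ⟨r, hr, hxr⟩ := hDZ hx.1
    rw [ae_restrict_iff' hDo.measurableSet] at hxr
    refine ⟨Metric.ball x r ∩ {y | ¬ (y ∈ D → f y = 0)}, ?_, ?_⟩
    · exact inter_mem (mem_nhdsWithin_of_mem_nhds (Metric.ball_mem_nhds x hr)) self_mem_nhdsWithin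
    · refine measure_mono_null (fun y hy => ?_) hxr
      simp only [mem_ofPred_eq, mem_compl_iff]
      intro hcon
      exact hy.2 fun hyD => hcon hyD (by simpa [dist_eq_norm] using hy.1)
  exact hnull

end

section

/-! ### Masses of product functions -/

/-- Tonelli's theorem for the extended norms; no finiteness is needed, since `toReal` is
multiplicative even at infinity. -/
theorem l2Norm_prod {X Y : Type*} [MeasureSpace X] [MeasureSpace Y]
    [SFinite (volume : Measure X)] [SFinite (volume : Measure Y)] {A : Set X} {B : Set Y}
    {φ : X → ℝ} {u : Y → ℝ} {v : X × Y → ℝ} (hv : ∀ x y, v (x, y) = φ x * u y)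
    (hφ : AEMeasurable φ (volume.restrict A)) (hu : AEMeasurable u (volume.restrict B)) :
    l2Norm (A ×ˢ B) v = l2Norm A φ * l2Norm B u := by
  have hv' : v = fun z => φ z.1 * u z.2 := funext fun z => hv z.1 z.2
  have key : eLpNorm v 2 (volume.restrict (A ×ˢ B))
      = eLpNorm φ 2 (volume.restrict A) * eLpNorm u 2 (volume.restrict B) := by
    simp only [eLpNorm_eq_lintegral_rpow_enorm_toReal two_ne_zero ENNReal.ofNat_ne_top]
    rw [← ENNReal.mul_rpow_of_nonneg _ _ (by positivity), Measure.volume_eq_prod,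
      ← Measure.prod_restrict, ← lintegral_prod_mul (hφ.enorm.pow_const _) (hu.enorm.pow_const _),
      hv']
    congr 1
    apply lintegral_congr
    intro z
    rw [enorm_mul, ENNReal.mul_rpow_of_nonneg _ _ (by positivity)]
  rw [l2Norm, key, ENNReal.toReal_mul]
  rfl

theorem l2Norm_nonneg {X : Type*} [MeasureSpace X] (s : Set X) (f : X → ℝ) : 0 ≤ l2Norm s f :=
  ENNReal.toReal_nonneg

theorem l2Norm_sq {X : Type*} [MeasureSpace X] {s : Set X} {f : X → ℝ}
    (hf : MemLp f 2 (volume.restrict s)) : l2Norm s f ^ 2 = ∫ x in s, f x ^ 2 := by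
  have hnn : 0 ≤ ∫ x in s, f x ^ 2 := integral_nonneg fun x => sq_nonneg _
  rw [l2Norm, hf.eLpNorm_eq_integral_rpow_norm two_ne_zero ENNReal.ofNat_ne_top]
  have : ∀ x, ‖f x‖ ^ (ENNReal.toReal 2) = f x ^ 2 := by
    intro x
    simp
  simp only [this]
  rw [ENNReal.toReal_ofReal (by positivity), ← Real.rpow_natCast, ← Real.rpow_mul hnn]
  simp

theorem l2Norm_mono {X : Type*} [MeasureSpace X] {s t : Set X} (hst : s ⊆ t) {f : X → ℝ}
    (hf : MemLp f 2 (volume.restrict t)) : l2Norm s f ≤ l2Norm t f :=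
  ENNReal.toReal_mono hf.2.ne (eLpNorm_mono_measure _ (Measure.restrict_mono_set _ hst))

/-- The finite initial segment has a positive minimum. This joins unique continuation, for small
indices, to nonconcentration, for large ones. -/
theorem exists_pos_le_of_eventually {x : ℕ → ℝ} (hx : ∀ k, 0 < x k) {δ : ℝ} (hδ : 0 < δ)
    (h : ∀ᶠ k in atTop, δ ≤ x k) : ∃ η > 0, ∀ k, η ≤ x k := by
  obtain ⟨N, hN⟩ := eventually_atTop.1 h
  have hfin : ∀ N, ∃ η > 0, ∀ k < N, η ≤ x k := by
    intro N
    induction N with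
    | zero => exact ⟨1, one_pos, fun k hk => absurd hk (Nat.not_lt_zero k)⟩
    | succ N ih =>
      obtain ⟨η, hη, hle⟩ := ih
      refine ⟨min η (x N), lt_min hη (hx N), fun k hk => ?_⟩
      rcases Nat.lt_succ_iff_lt_or_eq.1 hk with hk | rfl
      · exact (min_le_left _ _).trans (hle k hk)
      · exact min_le_right _ _
  obtain ⟨η, hη, hle⟩ := hfin N
  refine ⟨min η δ, lt_min hη hδ, fun k => ?_⟩
  rcases lt_or_ge k N with hk | hk
  · exact (min_le_left _ _).trans (hle k hk)
  · exact (min_le_right _ _).trans (hN k hk)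

/-! ### Masses of Dirichlet eigenfunctions and of normalized reduced eigenfunctions -/

variable {d : ℕ} {D : Set (EuclideanSpace ℝ (Fin d))} {μ : ℕ → ℝ}
  {φ : ℕ → EuclideanSpace ℝ (Fin d) → ℝ}

theorem IsDirichletSystem.memLp (hφ : IsDirichletSystem D μ φ) (k : ℕ) :
    MemLp (φ k) 2 (volume.restrict D) := by
  obtain ⟨g, h, hgh, -⟩ := hφ.eigen k
  exact hgh.1

theorem IsDirichletSystem.l2Norm_eq_one (hφ : IsDirichletSystem D μ φ) (k : ℕ) :
    l2Norm D (φ k) = 1 := by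
  have h1 := l2Norm_sq (hφ.memLp k)
  have h2 := hφ.orthonormal k k
  simp only [if_true, ← pow_two] at h2
  rw [h2] at h1
  exact (pow_eq_one_iff_of_nonneg (l2Norm_nonneg _ _) two_ne_zero).1 h1

/-- Dirichlet eigenfunctions on a connected set have mass in every nonempty open subset. -/
theorem IsDirichletSystem.l2Norm_pos (hφ : IsDirichletSystem D μ φ) (hDo : IsOpen D)
    (hDc : IsConnected D) (hDb : Bornology.IsBounded D) {W : Set (EuclideanSpace ℝ (Fin d))}
    (hWo : IsOpen W) (hWD : W ⊆ D) (hWne : W.Nonempty) (k : ℕ) : 0 < l2Norm W (φ k) := by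
  refine lt_of_le_of_ne (l2Norm_nonneg _ _) fun h0 => ?_
  have hmem := hφ.memLp k
  have hmemW : MemLp (φ k) 2 (volume.restrict W) :=
    hmem.mono_measure (Measure.restrict_mono_set _ hWD)
  have hW : φ k =ᵐ[volume.restrict W] 0 := by
    rw [l2Norm, eq_comm, ENNReal.toReal_eq_zero_iff] at h0
    exact (eLpNorm_eq_zero_iff hmemW.1 two_ne_zero).1 (h0.resolve_right hmemW.2.ne)
  have : IsFiniteMeasure (volume.restrict D) :=
    ⟨by rw [Measure.restrict_apply_univ]; exact hDb.measure_lt_top⟩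
  have hD := ae_eq_zero_of_ae_eq_zero_on hDo hDc (hmem.integrable one_le_two)
    (fun ψ hψ => (hφ.eigen k).integral_mul_sum_pderiv hDb hψ) hWo hWD hWne hW
  have h1 := hφ.l2Norm_eq_one k
  rw [l2Norm, eLpNorm_congr_ae hD] at h1
  simp at h1

/-- If the eigenfunctions do not concentrate outside `W`, their masses in `W` are uniformly
bounded below. -/
theorem IsDirichletSystem.exists_le_l2Norm (hφ : IsDirichletSystem D μ φ) (hDo : IsOpen D)
    (hDc : IsConnected D) (hDb : Bornology.IsBounded D) {W : Set (EuclideanSpace ℝ (Fin d))}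
    (hWo : IsOpen W) (hWD : W ⊆ D) (hW : W ≠ D → NotConcentratingOutside D W φ) :
    ∃ δ > 0, ∀ k, δ ≤ l2Norm W (φ k) := by
  by_cases hWeq : W = D
  · exact ⟨1, one_pos, fun k => by rw [hWeq, hφ.l2Norm_eq_one]⟩
  have hlim := hW hWeq
  have hrel : ∀ k, relMass D W (φ k) = l2Norm W (φ k) ^ 2 := fun k => by
    rw [relMass, hφ.l2Norm_eq_one]; simp
  -- For empty `W` every relative mass is zero, contradicting the positive lower limit.
  have hne : W.Nonempty := by
    by_contra hcon
    rw [not_nonempty_iff_eq_empty] at hcon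
    rw [NotConcentratingOutside] at hlim
    simp only [hrel] at hlim
    simp [hcon, l2Norm] at hlim
  obtain ⟨δ, hδ, hδlim⟩ := exists_between hlim
  have hev : ∀ᶠ k in atTop, δ < relMass D W (φ k) := by
    refine eventually_lt_of_lt_liminf hδlim ⟨0, ?_⟩
    simp only [eventually_map]
    exact Eventually.of_forall fun k => by rw [hrel]; positivity
  refine exists_pos_le_of_eventually (δ := √δ)
    (fun k => hφ.l2Norm_pos hDo hDc hDb hWo hWD hne k) (Real.sqrt_pos.2 hδ) ?_
  filter_upwards [hev] with k hk
  rw [hrel] at hk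
  exact Real.sqrt_le_iff.2 ⟨l2Norm_nonneg _ _, hk.le⟩

/-- The mass ratio of a reduced eigenfunction is bounded below. -/
theorem IsNormalizedEigenfunction.l2Norm_bounds {H cm cM ε V : ℝ} (hH : 0 < H) (hcm : 0 < cm)
    (hcM : cm < cM) (hε : 0 < ε) (hV : 0 ≤ V) {c : ℝ → ℝ} (hc : c ∈ CoeffsV H cm cM V)
    {m lam : ℝ} (hlam : (essSup c (volume.restrict (Ioo 0 H)) + ε) * m ^ 2 ≤ lam) {u : ℝ → ℝ}
    (hu : IsNormalizedEigenfunction H c m lam u) {a b : ℝ} (ha : 0 ≤ a) (hab : a < b)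
    (hb : b ≤ H) :
    MemLp u 2 (volume.restrict (Ioo 0 H)) ∧ 0 < l2Norm (Ioo 0 H) u ∧
      √(massConst H cm cM ε V a b * cm / cM) * l2Norm (Ioo 0 H) u ≤ l2Norm (Ioo a b) u := by
  have hcM0 : 0 < cM := hcm.trans hcM
  have hmass := hu.mass_le hH hcm hcM hε hV hc hlam ha hab hb
  have hmpos := massConst_pos (V := V) hH hcm hcM hε hab
  have hcont : ContinuousOn u (Icc 0 H) := by
    obtain ⟨⟨w, -, hd, -⟩, -⟩ := hu
    exact hd.continuousOn
  have hmem : MemLp u 2 (volume.restrict (Ioo 0 H)) := by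
    obtain ⟨C, hC⟩ := isCompact_Icc.exists_bound_of_continuousOn hcont
    refine MemLp.of_bound ((hcont.mono Ioo_subset_Icc_self).aestronglyMeasurable
      measurableSet_Ioo) C ?_
    filter_upwards [ae_restrict_mem measurableSet_Ioo] with y hy
    exact hC y (Ioo_subset_Icc_self hy)
  have hmem' : MemLp u 2 (volume.restrict (Ioo a b)) :=
    hmem.mono_measure (Measure.restrict_mono_set _ (Ioo_subset_Ioo ha hb))
  have hnorm := hu.2
  rw [intervalIntegral.integral_of_le hH.le, integral_Ioc_eq_integral_Ioo] at hnorm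
  rw [intervalIntegral.integral_of_le hab.le, integral_Ioc_eq_integral_Ioo] at hmass
  -- The integral of a non-integrable function is `0` by convention, so the normalization to `1`
  -- forces integrability.
  have hint : IntegrableOn (fun y => u y ^ 2 * (c y)⁻¹) (Ioo 0 H) := by
    by_contra hcon
    rw [integral_undef hcon] at hnorm
    exact zero_ne_one hnorm
  have hup : l2Norm (Ioo 0 H) u ^ 2 ≤ cM := by
    rw [l2Norm_sq hmem]
    calc ∫ y in Ioo 0 H, u y ^ 2 ≤ ∫ y in Ioo 0 H, cM * (u y ^ 2 * (c y)⁻¹) := by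
          refine integral_mono_ae hmem.integrable_sq (hint.const_mul _) ?_
          filter_upwards [hc.1.2] with y hy
          have hcy := hcm.trans_le hy.1
          have h1 : 1 ≤ cM * (c y)⁻¹ := by
            rw [← div_eq_mul_inv, one_le_div hcy]; exact hy.2
          have h2 := mul_le_mul_of_nonneg_left h1 (sq_nonneg (u y))
          linarith
      _ = cM := by rw [integral_const_mul, hnorm, mul_one]
  have hlow : massConst H cm cM ε V a b * cm ≤ l2Norm (Ioo a b) u ^ 2 := by
    rw [l2Norm_sq hmem']
    calc massConst H cm cM ε V a b * cm
        ≤ cm * ∫ y in Ioo a b, u y ^ 2 * (c y)⁻¹ := by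
          rw [mul_comm]; gcongr
      _ = ∫ y in Ioo a b, cm * (u y ^ 2 * (c y)⁻¹) := (integral_const_mul _ _).symm
      _ ≤ ∫ y in Ioo a b, u y ^ 2 := by
          refine integral_mono_ae
            ((hint.mono_set (Ioo_subset_Ioo ha hb)).const_mul _) hmem'.integrable_sq ?_
          filter_upwards [ae_restrict_of_ae_restrict_of_subset (Ioo_subset_Ioo ha hb) hc.1.2]
            with y hy
          have hcy := hcm.trans_le hy.1
          have h1 : cm * (c y)⁻¹ ≤ 1 := by
            rw [← div_eq_mul_inv, div_le_one hcy]; exact hy.1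
          have h2 := mul_le_mul_of_nonneg_left h1 (sq_nonneg (u y))
          linarith
  have hpos' : 0 < l2Norm (Ioo a b) u := by
    refine lt_of_le_of_ne (l2Norm_nonneg _ _) fun h => ?_
    rw [← h] at hlow
    have : 0 < massConst H cm cM ε V a b * cm := by positivity
    norm_num at hlow
    linarith
  refine ⟨hmem, hpos'.trans_le (l2Norm_mono (Ioo_subset_Ioo ha hb) hmem), ?_⟩
  refine abs_le_of_sq_le_sq' ?_ (l2Norm_nonneg _ _) |>.2
  rw [mul_pow, Real.sq_sqrt (by positivity)]
  calc massConst H cm cM ε V a b * cm / cM * l2Norm (Ioo 0 H) u ^ 2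
      ≤ massConst H cm cM ε V a b * cm / cM * cM := by gcongr
    _ = massConst H cm cM ε V a b * cm := by field_simp
    _ ≤ _ := hlow

end

end Layered

end

/-! ### The four conclusions -/

theorem theoremA {d : ℕ} (hd : 1 ≤ d) {D : Set (EuclideanSpace ℝ (Fin d))}
    (hDo : IsOpen D) (hDc : IsConnected D) (hDb : Bornology.IsBounded D)
    {μ : ℕ → ℝ} {φ : ℕ → EuclideanSpace ℝ (Fin d) → ℝ}
    (hφ : Layered.IsDirichletSystem D μ φ)
    {H cm cM ε V : ℝ} (hH : 0 < H) (hcm : 0 < cm) (hcM : cm < cM) (hε : 0 < ε) (hV : 0 < V) :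
    -- every coefficient of bounded variation satisfies the minimal amplitude hypothesis
    (∀ c ∈ Layered.Coeffs H cm cM, Layered.totalVar H c < ⊤ →
      Layered.MinimalAmplitudeHypothesis H ε μ c) ∧
    -- uniformly over the coefficients of total variation at most `V`
    (0 < ⨅ c ∈ Layered.CoeffsV H cm cM V, Layered.minAmplitudeSq H ε μ c) ∧
    -- uniform lower bound for the masses of the reduced eigenfunctions in `(a, b)`
    (∀ a b : ℝ, 0 ≤ a → a < b → b ≤ H →
      ∃ f > 0, ∀ c ∈ Layered.CoeffsV H cm cM V, ∀ k lam, (k, lam) ∈ Layered.nonGuided H ε μ c →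
        ∀ u, Layered.IsNormalizedEigenfunction H c (μ k) lam u →
          f ≤ ∫ y in a..b, u y ^ 2 * (c y)⁻¹) ∧
    -- uniform lower bound for the eigenfunctions `v(x, y) = φ_k(x) u(y)` in `W × (a, b)`
    (∀ a b : ℝ, 0 ≤ a → a < b → b ≤ H →
      ∀ W : Set (EuclideanSpace ℝ (Fin d)), IsOpen W → W ⊆ D →
        (W ≠ D → Layered.NotConcentratingOutside D W φ) →
        ∃ f > 0, ∀ c ∈ Layered.CoeffsV H cm cM V, ∀ k lam,
          (k, lam) ∈ Layered.nonGuided H ε μ c →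
          ∀ u, Layered.IsNormalizedEigenfunction H c (μ k) lam u →
            ∀ v : EuclideanSpace ℝ (Fin d) × ℝ → ℝ, (∀ x y, v (x, y) = φ k x * u y) →
              f ≤ Layered.l2Norm (W ×ˢ Set.Ioo a b) v / Layered.l2Norm (D ×ˢ Set.Ioo 0 H) v ∧
              Layered.l2Norm (W ×ˢ Set.Ioo a b) v / Layered.l2Norm (D ×ˢ Set.Ioo 0 H) v ≤ 1) := by
  refine ⟨fun c hc hcV => ?_, ?_, fun a b ha hab hb => ?_, fun a b ha hab hb W hWo hWD hW => ?_⟩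
  -- The uniform bound is applied with the variation of `c` itself in place of `V`. It may be zero,
  -- which is why the estimates assume only `0 ≤ V`.
  · have hc' : c ∈ Layered.CoeffsV H cm cM (Layered.totalVar H c).toReal :=
      ⟨hc, by rw [ENNReal.ofReal_toReal hcV.ne]⟩
    have he := Layered.amplitudeConst_pos (V := (Layered.totalVar H c).toReal) hH hcm hcM hε
    refine lt_of_lt_of_le (ENNReal.ofReal_pos.2 ?_)
      (Layered.le_minAmplitudeSq hH hcm hcM hε ENNReal.toReal_nonneg hc' μ)
    positivity
  · have he := Layered.amplitudeConst_pos (V := V) hH hcm hcM hε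
    refine lt_of_lt_of_le (ENNReal.ofReal_pos.2 ?_)
      (le_iInf₂ fun c hc => Layered.le_minAmplitudeSq hH hcm hcM hε hV.le hc μ)
    positivity
  · exact ⟨_, Layered.massConst_pos (V := V) hH hcm hcM hε hab, fun c hc k lam hk u hu =>
      hu.mass_le hH hcm hcM hε hV.le hc hk.2 ha hab hb⟩
  · obtain ⟨δ, hδ, hδle⟩ := hφ.exists_le_l2Norm hDo hDc hDb hWo hWD hW
    have hmpos := Layered.massConst_pos (V := V) hH hcm hcM hε hab
    have hcM0 : 0 < cM := hcm.trans hcM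
    refine ⟨δ * √(Layered.massConst H cm cM ε V a b * cm / cM),
      mul_pos hδ (Real.sqrt_pos.2 (by positivity)), fun c hc k lam hk u hu v hv => ?_⟩
    obtain ⟨hmem, hpos, hle⟩ := hu.l2Norm_bounds hH hcm hcM hε hV.le hc hk.2 ha hab hb
    have hsub : Set.Ioo a b ⊆ Set.Ioo 0 H := Set.Ioo_subset_Ioo ha hb
    have hφm := hφ.memLp k
    rw [Layered.l2Norm_prod hv hφm.1.aemeasurable hmem.1.aemeasurable,
      Layered.l2Norm_prod hv
        (hφm.1.aemeasurable.mono_measure (MeasureTheory.Measure.restrict_mono_set _ hWD))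
        (hmem.1.aemeasurable.mono_measure (MeasureTheory.Measure.restrict_mono_set _ hsub)),
      hφ.l2Norm_eq_one, one_mul]
    have hW1 : Layered.l2Norm W (φ k) ≤ 1 :=
      (Layered.l2Norm_mono hWD hφm).trans_eq (hφ.l2Norm_eq_one k)
    constructor
    · rw [le_div_iff₀ hpos, mul_assoc]
      exact mul_le_mul (hδle k) hle (by positivity) (Layered.l2Norm_nonneg _ _)
    · rw [div_le_one hpos]
      calc _ ≤ 1 * Layered.l2Norm (Set.Ioo a b) u :=
            mul_le_mul_of_nonneg_right hW1 (Layered.l2Norm_nonneg _ _)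
        _ ≤ _ := by rw [one_mul]; exact Layered.l2Norm_mono hsub hmem
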